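/- Let $T>0$, $\sigma>0$, $S_0,v\in\mathbb R$ be known, let $\Gamma\subseteq\mathbb R$ be a parameter set, let $f(v;\theta)$ be real valued, and let $G$ be a known real kernel that is Lebesgue integrable on $[0,T]$ (for example $G(s)\propto s^{-\gamma}$ or $G(s)\propto l_0(l_0+s)^{-\gamma}$ with $0<\gamma<1$, or $G(s)\propto e^{-\rho s}$). In the propagator model with parameter $\theta\in\Gamma$, the price process observed under $\mathbb P_\theta$ is $$S_t=S_0+\int_0^t f(v;\theta)\,G(t-s)\,ds+\sigma W_t,\qquad 0\le t\le T,$$ with a standard Brownian motion $W$ under $\mathbb P_\theta$. For $N\ge 1$ let $\Delta t=T/N$, $t_i=i\,\Delta t$, $S_{\rm full}=(S_{t_1},\dots,S_{t_N})$, $\phi(S_{\rm full})=\sum_{i=1}^N (S_{t_i}-S_{t_{i-1}})\int_{t_{i-1}}^{t_i}G(s)\,ds$, $J_{\rm discrete}=\sum_{i=1}^N S_{t_i}\Delta t$ and $J=\int_0^T S_t\,dt$. For a statistic $X$ write $\mathcal I_X(\theta)=\mathbb E_\theta\big[(\partial_\theta\log p_\theta(X))^2\big]$ for its Fisher information, where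 $p_\theta$ is the density of $X$ under $\mathbb P_\theta$ with respect to a $\sigma$-finite measure that dominates the laws of $X$ for parameters near $\theta$. (a) For every $N\ge 1$, the statistic $\phi(S_{\rm full})$ is sufficient for $\theta\in\Gamma$ in the experiment in which $S_{\rm full}$ is observed: the conditional distribution of $S_{\rm full}$ given $\phi(S_{\rm full})$ does not depend on $\theta\in\Gamma$. Let now $\theta$ be an interior point of $\Gamma$ at which $f(v;\cdot)$ is differentiable. Then all the Fisher informations below exist, and: (b) $\mathcal I_{S_{\rm full}}(\theta)=\mathcal I_{\phi(S_{\rm full})}(\theta)$ for every $N\ge 1$. (c) As $\Delta t\to0$, that is, $N\to\infty$, $$\mathcal I_{S_{\rm full}}(\theta)\to\frac{(\partial f/\partial\theta)^2}{\sigma^2}\int_0^T G^2(t)\,dt,$$ as a limit in $[0,\infty]$ with $0\cdot\infty=0$; it is a limit of real numbers if $\int_0^TG^2<\infty$. (d) As $\Delta t\to0$, $$\mathcal I_{J_{\rm discrete}}(\theta)\to\mathcal I_J(\theta)=\frac{(\partial f/\partial\theta)^2}{\sigma^2}\cdot\frac{3}{T^3}\Big(\int_0^T G(t)(T-t)\,dt\Big)^2.$$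 (e) For every $n\ge 0$ and all times $0=t_0\le t_1\le\dots\le t_n\le T$, the partial trajectory $S_{\rm partial}=(S_{t_0},\dots,S_{t_n})$ satisfies $$\mathcal I_{S_{\rm partial}}(\theta)=\frac{(\partial f/\partial\theta)^2}{\sigma^2}\sum_{i=1}^{n}\frac{\big(\int_{t_{i-1}}^{t_i}G(t)\,dt\big)^2}{t_i-t_{i-1}},$$ where a summand with $t_i=t_{i-1}$ is read as $0$. -/

import Mathlib

open MeasureTheory ProbabilityTheory Filter Topology
open scoped ENNReal NNReal

namespace Propagator

section Statistics

variable {E F : Type*} [MeasurableSpace E] [MeasurableSpace F]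

/-- `p` is a family of likelihood functions, with respect to the dominating measure `ν`, for the
experiment `Q`, for all parameters close to `θ₀`. -/
def IsLikelihoodNear (Q : ℝ → Measure E) (θ₀ : ℝ) (ν : Measure E) (p : ℝ → E → ℝ) : Prop :=
  ∀ᶠ θ in 𝓝 θ₀, IsProbabilityMeasure (Q θ) ∧ Measurable (p θ) ∧ (∀ x, 0 ≤ p θ x) ∧
    Q θ = ν.withDensity (fun x => ENNReal.ofReal (p θ x))

/-- The log-likelihood `θ ↦ log p_θ(x)` is well defined near `θ₀` and differentiable at `θ₀`, for
almost every sample `x` under the parameter `θ₀`. -/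
def HasScoreAt (Q : ℝ → Measure E) (θ₀ : ℝ) (p : ℝ → E → ℝ) : Prop :=
  ∀ᵐ x ∂(Q θ₀), (∀ᶠ θ in 𝓝 θ₀, 0 < p θ x) ∧
    DifferentiableAt ℝ (fun θ => Real.log (p θ x)) θ₀

/-- The experiment `Q` (a family of probability measures on the sample space `E`, indexed by a real
parameter) has the Fisher information `I` at `θ₀`: the family is dominated near `θ₀`, and
`I` is the expectation under `θ₀` of the square of the score
`∂/∂θ log p_θ(x)` at `θ = θ₀`, which is square integrable. -/
def HasFisherInfo (Q : ℝ → Measure E) (θ₀ I : ℝ) : Prop :=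
  ∃ (ν : Measure E) (p : ℝ → E → ℝ), SigmaFinite ν ∧ IsLikelihoodNear Q θ₀ ν p ∧
    HasScoreAt Q θ₀ p ∧
    Integrable (fun x => (deriv (fun θ => Real.log (p θ x)) θ₀) ^ 2) (Q θ₀) ∧
    I = ∫ x, (deriv (fun θ => Real.log (p θ x)) θ₀) ^ 2 ∂(Q θ₀)

open Classical in
/-- The Fisher information of the experiment `Q` at `θ₀` (with the value `0` if there is none). -/
noncomputable def fisherInfo (Q : ℝ → Measure E) (θ₀ : ℝ) : ℝ :=
  if h : ∃ I, HasFisherInfo Q θ₀ I then h.choose else 0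

/-- Likelihood ratios do not depend on the dominating measure. -/
theorem likelihood_ratio {μ μ₀ ν : Measure E} [SigmaFinite ν] [IsFiniteMeasure μ]
    [IsFiniteMeasure μ₀] {p p₀ : E → ℝ} (hp : Measurable p) (hp₀ : Measurable p₀)
    (h0 : ∀ x, 0 ≤ p x) (h00 : ∀ x, 0 ≤ p₀ x)
    (hμ : μ = ν.withDensity (fun x => ENNReal.ofReal (p x)))
    (hμ₀ : μ₀ = ν.withDensity (fun x => ENNReal.ofReal (p₀ x))) :
    ∀ᵐ x ∂μ₀, p x / p₀ x =
      (μ.rnDeriv (μ + μ₀) x).toReal / (μ₀.rnDeriv (μ + μ₀) x).toReal := by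
  have hac : μ₀ ≪ ν := by rw [hμ₀]; exact withDensity_absolutelyContinuous _ _
  have hsum : μ + μ₀ = ν.withDensity (fun x => ENNReal.ofReal (p x + p₀ x)) := by
    rw [hμ, hμ₀, ← withDensity_add_left (by fun_prop)]
    congr 1
    funext x
    simp [ENNReal.ofReal_add (h0 x) (h00 x)]
  have e1 : μ.rnDeriv ν =ᵐ[ν] fun x => ENNReal.ofReal (p x) := by
    rw [hμ]; exact Measure.rnDeriv_withDensity ν (by fun_prop)
  have e2 : μ₀.rnDeriv ν =ᵐ[ν] fun x => ENNReal.ofReal (p₀ x) := by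
    rw [hμ₀]; exact Measure.rnDeriv_withDensity ν (by fun_prop)
  have e3 : (μ + μ₀).rnDeriv ν =ᵐ[ν] fun x => ENNReal.ofReal (p x + p₀ x) := by
    rw [hsum]; exact Measure.rnDeriv_withDensity ν (by fun_prop)
  have a1 : μ ≪ μ + μ₀ := Measure.AbsolutelyContinuous.rfl.add_right μ₀
  have a2 : μ₀ ≪ μ + μ₀ := by
    rw [add_comm]; exact Measure.AbsolutelyContinuous.rfl.add_right μ
  have m1 := Measure.rnDeriv_mul_rnDeriv (κ := ν) a1
  have m2 := Measure.rnDeriv_mul_rnDeriv (κ := ν) a2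
  have hpos : ∀ᵐ x ∂μ₀, 0 < p₀ x := by
    rw [hμ₀, ae_withDensity_iff (by fun_prop)]
    refine Eventually.of_forall fun x hx => ?_
    simpa using hx
  filter_upwards [hpos, hac e1, hac e2, hac e3, hac m1, hac m2] with x hx h1 h2 h3 h4 h5
  simp only [Pi.mul_apply] at h1 h2 h3 h4 h5
  rw [h1, h3] at h4
  rw [h2, h3] at h5
  have hs : 0 < p x + p₀ x := by linarith [h0 x]
  have h4' := congrArg ENNReal.toReal h4
  have h5' := congrArg ENNReal.toReal h5
  rw [ENNReal.toReal_mul, ENNReal.toReal_ofReal hs.le, ENNReal.toReal_ofReal (h0 x)] at h4'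
  rw [ENNReal.toReal_mul, ENNReal.toReal_ofReal hs.le, ENNReal.toReal_ofReal (h00 x)] at h5'
  calc p x / p₀ x = (μ.rnDeriv (μ + μ₀) x).toReal * (p x + p₀ x) /
        ((μ₀.rnDeriv (μ + μ₀) x).toReal * (p x + p₀ x)) := by rw [h4', h5']
    _ = _ := mul_div_mul_right _ _ hs.ne'

/-- The Fisher information does not depend on the choice of the dominating measure and of the
likelihood functions. -/
theorem HasFisherInfo.unique {Q : ℝ → Measure E} {θ₀ I I' : ℝ} (h : HasFisherInfo Q θ₀ I)
    (h' : HasFisherInfo Q θ₀ I') : I = I' := by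
  obtain ⟨ν, p, hν, hp, hs, -, rfl⟩ := h
  obtain ⟨ν', p', hν', hp', hs', -, rfl⟩ := h'
  have hboth := hp.and hp'
  obtain ⟨⟨hQ0, hm0, hn0, hd0⟩, -, hm0', hn0', hd0'⟩ := hboth.self_of_nhds
  let u : ℕ → ℝ := fun k => θ₀ + 1 / ((k : ℝ) + 1)
  have hu : Tendsto u atTop (𝓝 θ₀) := by
    simpa [u] using tendsto_one_div_add_atTop_nhds_zero_nat.const_add θ₀
  have hune : ∀ k, u k ≠ θ₀ := fun k => by
    have : (0 : ℝ) < 1 / ((k : ℝ) + 1) := by positivity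
    simp only [u]; intro h; linarith
  have hu' : Tendsto u atTop (𝓝[≠] θ₀) :=
    tendsto_nhdsWithin_iff.2 ⟨hu, Eventually.of_forall hune⟩
  obtain ⟨K, hK⟩ := eventually_atTop.1 (hu.eventually hboth)
  have hr : ∀ᵐ x ∂(Q θ₀), ∀ k, K ≤ k →
      p (u k) x / p θ₀ x = p' (u k) x / p' θ₀ x := by
    rw [ae_all_iff]
    intro k
    by_cases hk : K ≤ k
    · obtain ⟨⟨hQ, hm, hn, hd⟩, -, hm', hn', hd'⟩ := hK k hk
      filter_upwards [likelihood_ratio hm hm0 hn hn0 hd hd0,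
        likelihood_ratio hm' hm0' hn' hn0' hd' hd0'] with x h1 h2 _
      rw [h1, h2]
    · exact Eventually.of_forall fun x hx => absurd hx hk
  apply integral_congr_ae
  filter_upwards [hr, hs, hs'] with x hx ⟨hpos, hdiff⟩ ⟨hpos', hdiff'⟩
  have t := hdiff.hasDerivAt.tendsto_slope.comp hu'
  have t' := hdiff'.hasDerivAt.tendsto_slope.comp hu'
  have heq : (slope (fun θ => Real.log (p θ x)) θ₀ ∘ u) =ᶠ[atTop]
      (slope (fun θ => Real.log (p' θ x)) θ₀ ∘ u) := by
    filter_upwards [eventually_ge_atTop K, hu.eventually hpos, hu.eventually hpos']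
      with k hk h1 h2
    have q0 := hpos.self_of_nhds
    have q0' := hpos'.self_of_nhds
    simp only [Function.comp, slope_def_field]
    rw [← Real.log_div h1.ne' q0.ne', ← Real.log_div h2.ne' q0'.ne', hx k hk]
  rw [tendsto_nhds_unique t (t'.congr' heq.symm)]

theorem HasFisherInfo.fisherInfo_eq {Q : ℝ → Measure E} {θ₀ I : ℝ} (h : HasFisherInfo Q θ₀ I) :
    fisherInfo Q θ₀ = I := by
  have hex : ∃ I, HasFisherInfo Q θ₀ I := ⟨I, h⟩
  rw [fisherInfo, dif_pos hex]
  exact hex.choose_spec.unique h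

/-- The statistic `φ` is sufficient for the experiment `{Q θ : θ ∈ Γ}`: the conditional distribution
of the sample given `φ` is one and the same Markov kernel for all the parameters in `Γ`. -/
def IsSufficient (Γ : Set ℝ) (Q : ℝ → Measure E) (φ : E → F) : Prop :=
  Measurable φ ∧ ∃ κ : Kernel F E, IsMarkovKernel κ ∧ ∀ θ ∈ Γ, HasCondDistrib id φ κ (Q θ)

end Statistics

section Model

variable {Ω : Type*} [MeasurableSpace Ω]

/-- The propagator model for a metaorder executed at the constant rate `v` during `[0, T]`: under
each `P θ`, the observed price process `S` satisfies
`S_t = S₀ + ∫_0^t f(v; θ) G(t - s) ds + σ W_t` on `[0, T]` for a standard Brownian motion `W`. -/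
def IsPropagatorModel (Γ : Set ℝ) (T σ S₀ v : ℝ) (f : ℝ → ℝ → ℝ) (G : ℝ → ℝ)
    (P : ℝ → Measure Ω) (S : ℝ → Ω → ℝ) : Prop :=
  ∀ θ ∈ Γ, ∃ W : ℝ≥0 → Ω → ℝ, IsBrownianReal W (P θ) ∧
    ∀ᵐ ω ∂(P θ), ∀ t ∈ Set.Icc 0 T,
      S t ω = S₀ + (∫ s in (0 : ℝ)..t, f v θ * G (t - s)) + σ * W t.toNNReal ω

/-- The experiment in which the statistic `X` is observed: the laws of `X` under the `P θ`. -/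
noncomputable def experiment {E : Type*} [MeasurableSpace E] (P : ℝ → Measure Ω) (X : Ω → E) :
    ℝ → Measure E :=
  fun θ => (P θ).map X

/-- The grid point `t_i = i Δt`, where `Δt = T / N`. -/
noncomputable def gridPt (T : ℝ) (N i : ℕ) : ℝ := i * (T / N)

/-- The full-grid observations `(S_{t_1}, …, S_{t_N})`. -/
noncomputable def fullPath (T : ℝ) (S : ℝ → Ω → ℝ) (N : ℕ) (ω : Ω) : Fin N → ℝ :=
  fun i => S (gridPt T N (i + 1)) ω

/-- The statistic `φ(x_1, …, x_N) = ∑_{i=1}^N (x_i - x_{i-1}) ∫_{t_{i-1}}^{t_i} G(s) ds`, where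
`x_0` is the known initial price `S₀`. -/
noncomputable def phi (T S₀ : ℝ) (G : ℝ → ℝ) (N : ℕ) (x : Fin N → ℝ) : ℝ :=
  ∑ i : Fin N, ((Fin.cons S₀ x : Fin (N + 1) → ℝ) i.succ -
      (Fin.cons S₀ x : Fin (N + 1) → ℝ) i.castSucc) *
    ∫ s in (gridPt T N i)..(gridPt T N (i + 1)), G s

/-- The true VWAP cost `J = ∫_0^T S_t dt`. -/
noncomputable def vwapCost (T : ℝ) (S : ℝ → Ω → ℝ) (ω : Ω) : ℝ := ∫ t in (0 : ℝ)..T, S t ω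

/-- The discrete VWAP cost `∑_{i=1}^N S_{t_i} Δt`. -/
noncomputable def vwapCostDiscrete (T : ℝ) (S : ℝ → Ω → ℝ) (N : ℕ) (ω : Ω) : ℝ :=
  ∑ i : Fin N, S (gridPt T N (i + 1)) ω * (T / N)

/-- The observations `(S_{t_0}, S_{t_1}, …, S_{t_n})` of a partial trajectory. -/
def partialPath {n : ℕ} (S : ℝ → Ω → ℝ) (t : Fin (n + 1) → ℝ) (ω : Ω) : Fin (n + 1) → ℝ :=
  fun i => S (t i) ω

end Model

end Propagator

/-! Along any time grid the increments of the price are independent Gaussians: on a cell of length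
`d` the mean is `f v θ * g`, where `g` is the integral of `G` over the cell, and the variance is `σ
^ 2 * d`. The parameter thus enters only through the scalar `a = f v θ`, which shifts a Gaussian
vector along the fixed direction `g`. Relative to the centred law the likelihood is `exp (a L - a² V
/ 2)` with `L = ∑ g_i x_i / v_i` and `V = ∑ g_i² / v_i`.

The score is therefore `a' (L - a V)` and the information is `a'² V`, for the whole sample and for
every statistic that retains `L` (`hasFisherInfo_of_pi_gaussianReal`). On the equidistant grid all
`v_i` agree, so `L` is a multiple of `φ`. This gives sufficiency, by factorization, and the equality
of the two informations. Repeated observation times have `v_i = g_i = 0` and contribute nothing.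

The discrete cost is a linear form in the increments, by Abel summation, and the true cost is its
almost sure limit along continuous paths. Both are Gaussian, with information `a'²` times squared
mean coefficient over variance, and these two quantities converge.

For the full path, `∑ g_i² / Δt` is the squared L² norm of the cell averages of `G`. Cauchy–Schwarz
bounds it above by `∫ G²`; Lebesgue differentiation and Fatou give the matching lower bound, whether
or not `∫ G²` is finite. -/

namespace Propagator

/-! ### Gaussian shifts: densities relative to the centred law, and laws of linear forms. -/

section GaussianShift

/-- For `v = 0` both laws are the Dirac mass at `0`, and division by zero makes the exponent `0`.
Admitting this case later covers repeated observation times. -/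
theorem gaussianReal_eq_withDensity {m : ℝ} {v : ℝ≥0} (h : v = 0 → m = 0) :
    gaussianReal m v = (gaussianReal 0 v).withDensity
      (fun x => ENNReal.ofReal (Real.exp (m * x / v - m ^ 2 / v / 2))) := by
  rcases eq_or_ne v 0 with hv | hv
  · simp [hv, h hv]
  · rw [gaussianReal_of_var_ne_zero _ hv, gaussianReal_of_var_ne_zero _ hv,
      ← withDensity_mul _ (by fun_prop) (by fun_prop)]
    congr 1
    funext x
    simp only [Pi.mul_apply, gaussianPDF, gaussianPDFReal]
    rw [← ENNReal.ofReal_mul (by positivity), mul_assoc _ (Real.exp _), ← Real.exp_add]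
    congr 3
    have : (v : ℝ) ≠ 0 := by exact_mod_cast hv
    field_simp
    ring

/-- It suffices to test boxes. There indicator times density is a product of functions of single
coordinates, which are independent under the product measure. -/
theorem pi_withDensity {ι : Type*} [Fintype ι] {X : ι → Type*} [∀ i, MeasurableSpace (X i)]
    (μ : ∀ i, Measure (X i)) [∀ i, IsProbabilityMeasure (μ i)] (h : ∀ i, X i → ℝ≥0∞)
    (hh : ∀ i, Measurable (h i)) [∀ i, IsProbabilityMeasure ((μ i).withDensity (h i))] :
    Measure.pi (fun i => (μ i).withDensity (h i)) =
      (Measure.pi μ).withDensity (fun x => ∏ i, h i (x i)) := by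
  refine Measure.pi_eq (μ := fun i => (μ i).withDensity (h i)) fun s hs => ?_
  rw [withDensity_apply _ (MeasurableSet.univ_pi hs),
    ← lintegral_indicator (MeasurableSet.univ_pi hs)]
  have hind : (Set.univ.pi s).indicator (fun x : ∀ i, X i => ∏ i, h i (x i)) =
      fun x => ∏ i, (s i).indicator (h i) (x i) := by
    classical
    funext x
    by_cases hx : x ∈ Set.univ.pi s
    · rw [Set.indicator_of_mem hx]
      exact Finset.prod_congr rfl fun i _ => (Set.indicator_of_mem (hx i (Set.mem_univ i)) _).symm
    · rw [Set.indicator_of_notMem hx]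
      simp only [Set.mem_pi, Set.mem_univ, true_implies, not_forall] at hx
      obtain ⟨i, hi⟩ := hx
      exact (Finset.prod_eq_zero (Finset.mem_univ i) (Set.indicator_of_notMem hi _)).symm
  rw [hind]
  have hind := iIndepFun_pi (μ := μ) (X := fun i => (s i).indicator (h i))
    (fun i => ((hh i).indicator (hs i)).aemeasurable)
  rw [lintegral_prod_eq_prod_lintegral_of_indepFun Finset.univ
    (fun i (x : ∀ i, X i) => (s i).indicator (h i) (x i)) hind
    (fun i => ((hh i).indicator (hs i)).comp (measurable_pi_apply i))]
  refine Finset.prod_congr rfl fun i _ => ?_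
  rw [withDensity_apply _ (hs i), ← lintegral_indicator (hs i)]
  exact (measurePreserving_eval μ i).lintegral_comp ((hh i).indicator (hs i))

variable {ι : Type*} [Fintype ι]

/-- The sample enters only through one linear form, whatever `c` is; this is what makes the model a
one-parameter exponential family. -/
theorem pi_gaussianReal_eq_withDensity {g : ι → ℝ} {v : ι → ℝ≥0} (h : ∀ i, v i = 0 → g i = 0)
    (c : ℝ) :
    Measure.pi (fun i => gaussianReal (c * g i) (v i)) =
      (Measure.pi fun i => gaussianReal 0 (v i)).withDensity (fun x => ENNReal.ofReal
        (Real.exp (c * ∑ i, g i * x i / v i - c ^ 2 * (∑ i, g i ^ 2 / v i) / 2))) := by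
  have key : ∀ i, gaussianReal (c * g i) (v i) = (gaussianReal 0 (v i)).withDensity
      (fun x => ENNReal.ofReal (Real.exp ((c * g i) * x / v i - (c * g i) ^ 2 / v i / 2))) :=
    fun i => gaussianReal_eq_withDensity fun hv => by simp [h i hv]
  have : ∀ i, IsProbabilityMeasure ((gaussianReal 0 (v i)).withDensity
      (fun x => ENNReal.ofReal (Real.exp ((c * g i) * x / v i - (c * g i) ^ 2 / v i / 2)))) :=
    fun i => by rw [← key i]; infer_instance
  simp_rw [key]
  rw [pi_withDensity _ _ (fun i => by fun_prop)]
  congr 1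
  funext x
  rw [← ENNReal.ofReal_prod_of_nonneg (fun i _ => (Real.exp_pos _).le), ← Real.exp_sum]
  congr 2
  rw [Finset.sum_sub_distrib, Finset.mul_sum, Finset.mul_sum, Finset.sum_div]
  congr 1 <;> exact Finset.sum_congr rfl fun i _ => by ring

theorem map_pi_gaussianReal_sum (m : ι → ℝ) (v : ι → ℝ≥0) (c : ι → ℝ) :
    (Measure.pi fun i => gaussianReal (m i) (v i)).map (fun x => ∑ i, c i * x i) =
      gaussianReal (∑ i, c i * m i) (Real.toNNReal (∑ i, c i ^ 2 * v i)) := by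
  have hind := iIndepFun_pi (μ := fun i => gaussianReal (m i) (v i)) (X := fun i x => c i * x)
    (fun i => by fun_prop)
  refine Measure.ext_of_charFun ?_
  funext t
  rw [hind.charFun_map_fun_sum_eq_prod
    (fun i => ((measurable_pi_apply i).const_mul (c i)).aemeasurable), charFun_gaussianReal]
  have : ∀ i, charFun ((Measure.pi fun i => gaussianReal (m i) (v i)).map
      (fun x => c i * x i)) t =
      Complex.exp (t * (c i * m i) * Complex.I - (c i ^ 2 * v i) * t ^ 2 / 2) := by
    intro i
    have : (Measure.pi fun i => gaussianReal (m i) (v i)).map (fun x => c i * x i) =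
        gaussianReal (c i * m i) (.mk (c i ^ 2) (sq_nonneg _) * v i) := by
      rw [← gaussianReal_map_const_mul,
        ← (measurePreserving_eval (fun i => gaussianReal (m i) (v i)) i).map_eq,
        Measure.map_map (by fun_prop) (by fun_prop)]
      rfl
    rw [this, charFun_gaussianReal]
    push_cast
    rfl
  simp only [Finset.prod_apply, this]
  rw [← Complex.exp_sum, Finset.sum_sub_distrib]
  have hnn : 0 ≤ ∑ i, c i ^ 2 * (v i : ℝ) := Finset.sum_nonneg fun i _ => by positivity
  rw [show ((Real.toNNReal (∑ i, c i ^ 2 * (v i : ℝ)) : ℝ≥0) : ℂ) =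
    ((∑ i, c i ^ 2 * (v i : ℝ) : ℝ) : ℂ) by rw [← Real.coe_toNNReal _ hnn]; simp [hnn]]
  push_cast
  rw [Finset.mul_sum, Finset.sum_mul, Finset.sum_mul, Finset.sum_div]

end GaussianShift

/-! ### Fisher information and sufficiency in a one-parameter exponential family. -/

section ExponentialFamily

variable {E F : Type*} [MeasurableSpace E] [MeasurableSpace F]

/-- A curved one-dimensional Gaussian exponential family with natural parameter `a θ` and
natural statistic `L` has the Fisher information `(a' θ)² I`. -/
theorem hasFisherInfo_of_exponential {Q : ℝ → Measure E} {θ₀ : ℝ} {a : ℝ → ℝ} {L : E → ℝ}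
    {V : ℝ≥0} {ν : Measure E} [SigmaFinite ν] (ha : DifferentiableAt ℝ a θ₀) (hL : Measurable L)
    (hQ : ∀ᶠ θ in 𝓝 θ₀, IsProbabilityMeasure (Q θ) ∧ Q θ = ν.withDensity
      (fun x => ENNReal.ofReal (Real.exp (a θ * L x - a θ ^ 2 * V / 2))))
    (hlaw : (Q θ₀).map L = gaussianReal (a θ₀ * V) V) :
    HasFisherInfo Q θ₀ (deriv a θ₀ ^ 2 * V) := by
  -- The score is `a'` times the centred natural statistic, so its second moment is `a'²` times the
  -- variance of `L`.
  have hscore : ∀ x, HasDerivAt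
      (fun θ => Real.log (Real.exp (a θ * L x - a θ ^ 2 * V / 2)))
      (deriv a θ₀ * (L x - a θ₀ * V)) θ₀ := by
    intro x
    simp only [Real.log_exp]
    have h := ha.hasDerivAt
    refine ((h.mul_const (L x)).fun_sub
      (((h.fun_pow 2).mul_const (V : ℝ)).div_const 2)).congr_deriv ?_
    push_cast
    ring
  have hml : MemLp (fun y : ℝ => y - a θ₀ * V) 2 (gaussianReal (a θ₀ * V) V) :=
    (memLp_id_gaussianReal 2).sub (memLp_const _)
  refine ⟨ν, fun θ x => Real.exp (a θ * L x - a θ ^ 2 * V / 2), inferInstance, ?_, ?_, ?_, ?_⟩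
  · filter_upwards [hQ] with θ hθ
    exact ⟨hθ.1, by fun_prop, fun x => (Real.exp_pos _).le, hθ.2⟩
  · exact Eventually.of_forall fun x =>
      ⟨Eventually.of_forall fun θ => Real.exp_pos _, (hscore x).differentiableAt⟩
  · simp only [(hscore _).deriv, mul_pow]
    refine Integrable.const_mul ?_ _
    have := hml.integrable_sq
    rw [← hlaw] at this
    exact this.comp_measurable hL
  · simp only [(hscore _).deriv, mul_pow]
    rw [integral_const_mul]
    congr 1
    have h1 : ∫ x, (L x - a θ₀ * V) ^ 2 ∂(Q θ₀) =
        ∫ y, (y - a θ₀ * V) ^ 2 ∂(gaussianReal (a θ₀ * V) V) := by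
      rw [← hlaw, integral_map hL.aemeasurable (by fun_prop)]
    rw [h1]
    have h2 := variance_fun_id_gaussianReal (μ := a θ₀ * V) (v := V)
    rw [variance_eq_integral (by fun_prop), integral_id_gaussianReal] at h2
    exact h2.symm

theorem map_withDensity_comp {μ : Measure E} {A : E → F} (hA : Measurable A) {k : F → ℝ≥0∞}
    (hk : Measurable k) :
    (μ.withDensity (fun x => k (A x))).map A = (μ.map A).withDensity k := by
  ext s hs
  rw [Measure.map_apply hA hs, withDensity_apply _ (hA hs), withDensity_apply _ hs,
    setLIntegral_map hs hk hA]

/-- Fisher–Neyman factorization: if the likelihood depends on the sample only through `φ`, then `φ`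
is sufficient. -/
theorem isSufficient_of_withDensity [StandardBorelSpace E] [Nonempty E] {Γ : Set ℝ}
    {Q : ℝ → Measure E} {φ : E → F} (hφ : Measurable φ) (ν : Measure E) [IsFiniteMeasure ν]
    (h : ℝ → F → ℝ≥0∞) (hh : ∀ θ, Measurable (h θ))
    (hQ : ∀ θ ∈ Γ, Q θ = ν.withDensity (fun x => h θ (φ x))) : IsSufficient Γ Q φ := by
  -- The common kernel is the conditional distribution under the dominating measure: the weight `h θ
  -- ∘ φ` is constant on the fibres of `φ` and only reweights the law of `φ`.
  refine ⟨hφ, condDistrib id φ ν, inferInstance, fun θ hθ => ?_⟩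
  refine ⟨by fun_prop, ?_⟩
  rw [hQ θ hθ, map_withDensity_comp hφ (hh θ)]
  have h1 := map_withDensity_comp (μ := ν) (A := fun x => (φ x, id x)) (k := fun p => h θ p.1)
    (by fun_prop) (by fun_prop)
  simp only at h1
  rw [h1, ← compProd_map_condDistrib (by fun_prop)]
  ext s hs
  rw [withDensity_apply _ hs, Measure.compProd_apply hs, ← lintegral_indicator hs,
    Measure.lintegral_compProd ((by fun_prop : Measurable fun p : F × E => h θ p.1).indicator hs),
    lintegral_withDensity_eq_lintegral_mul _ (hh θ) (Kernel.measurable_kernel_prodMk_left hs)]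
  refine lintegral_congr fun y => ?_
  rw [Pi.mul_apply, ← lintegral_indicator_const (measurable_prodMk_left hs)]
  rfl

variable {ι : Type*} [Fintype ι]

/-- The density factors through `A` by way of `ℓ`, so passing to the image leaves the exponent
unchanged and no information is lost. -/
theorem map_pi_gaussianReal_eq_withDensity {g : ι → ℝ} {v : ι → ℝ≥0}
    (h : ∀ i, v i = 0 → g i = 0) {A : (ι → ℝ) → E} (hA : Measurable A) {ℓ : E → ℝ}
    (hℓ : Measurable ℓ) (hAℓ : ∀ x, ℓ (A x) = ∑ i, g i * x i / v i) (c : ℝ) :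
    (Measure.pi fun i => gaussianReal (c * g i) (v i)).map A =
      ((Measure.pi fun i => gaussianReal 0 (v i)).map A).withDensity (fun x => ENNReal.ofReal
        (Real.exp (c * ℓ x - c ^ 2 * (∑ i, g i ^ 2 / v i) / 2))) := by
  rw [pi_gaussianReal_eq_withDensity h, ← map_withDensity_comp hA (by fun_prop)]
  simp_rw [hAℓ]

/-- The Fisher information of a Gaussian shift experiment, observed through a map `A` which retains
the natural statistic. -/
theorem hasFisherInfo_of_pi_gaussianReal {Q : ℝ → Measure E} {θ₀ : ℝ} {a : ℝ → ℝ}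
    (ha : DifferentiableAt ℝ a θ₀) {g : ι → ℝ} {v : ι → ℝ≥0} (h : ∀ i, v i = 0 → g i = 0)
    {A : (ι → ℝ) → E} (hA : Measurable A) {ℓ : E → ℝ} (hℓ : Measurable ℓ)
    (hAℓ : ∀ x, ℓ (A x) = ∑ i, g i * x i / v i)
    (hQ : ∀ᶠ θ in 𝓝 θ₀, Q θ = (Measure.pi fun i => gaussianReal (a θ * g i) (v i)).map A) :
    HasFisherInfo Q θ₀ (deriv a θ₀ ^ 2 * ∑ i, g i ^ 2 / v i) := by
  have hnn : 0 ≤ ∑ i, g i ^ 2 / (v i : ℝ) := Finset.sum_nonneg fun i _ => by positivity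
  have hprob : IsProbabilityMeasure ((Measure.pi fun i => gaussianReal 0 (v i)).map A) :=
    Measure.isProbabilityMeasure_map hA.aemeasurable
  have key := hasFisherInfo_of_exponential (Q := Q) (V := Real.toNNReal (∑ i, g i ^ 2 / v i))
    (ν := (Measure.pi fun i => gaussianReal 0 (v i)).map A) ha hℓ ?_ ?_
  · rwa [Real.coe_toNNReal _ hnn] at key
  · filter_upwards [hQ] with θ hθ
    rw [hθ]
    refine ⟨Measure.isProbabilityMeasure_map hA.aemeasurable, ?_⟩
    rw [Real.coe_toNNReal _ hnn]
    exact map_pi_gaussianReal_eq_withDensity h hA hℓ hAℓ _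
  · rw [hQ.self_of_nhds, Measure.map_map hℓ hA, Real.coe_toNNReal _ hnn]
    -- With weights `g i / v i` the variance is `∑ (g i / v i)² v i = ∑ g i² / v i`, and the mean is
    -- `a θ₀` times the same number.
    have : ℓ ∘ A = fun x => ∑ i, (g i / v i) * x i := by
      funext x
      simp only [Function.comp, hAℓ]
      exact Finset.sum_congr rfl fun i _ => by ring
    rw [this, map_pi_gaussianReal_sum, Finset.mul_sum]
    congr 2
    · funext i
      ring
    · refine Finset.sum_congr rfl fun i _ => ?_
      rcases eq_or_ne (v i : ℝ) 0 with hv | hv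
      · simp [hv]
      · field_simp

/-- The Fisher information of a Gaussian location experiment on the line. -/
theorem hasFisherInfo_of_gaussianReal {Q : ℝ → Measure ℝ} {θ₀ : ℝ} {a : ℝ → ℝ}
    (ha : DifferentiableAt ℝ a θ₀) {b k : ℝ} {V : ℝ≥0} (h : V = 0 → k = 0)
    (hQ : ∀ᶠ θ in 𝓝 θ₀, Q θ = gaussianReal (b + a θ * k) V) :
    HasFisherInfo Q θ₀ (deriv a θ₀ ^ 2 * (k ^ 2 / V)) := by
  -- A single coordinate suffices; the known offset `b` is put into the observation map.
  have key := hasFisherInfo_of_pi_gaussianReal (Q := Q) (ι := Unit) ha (g := fun _ => k)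
    (v := fun _ => V) (fun _ => h) (A := fun x => b + x ()) (by fun_prop)
    (ℓ := fun y => k * (y - b) / V) (by fun_prop) (by simp) ?_
  · simpa using key
  · filter_upwards [hQ] with θ hθ
    have h1 := Measure.map_map (μ := Measure.pi fun _ : Unit => gaussianReal (a θ * k) V)
      (g := fun y => b + y) (f := Function.eval ()) (by fun_prop) (by fun_prop)
    rw [(measurePreserving_eval (fun _ : Unit => gaussianReal (a θ * k) V) ()).map_eq,
      gaussianReal_map_const_add, add_comm _ b] at h1
    rw [hθ, h1]
    rfl

end ExponentialFamily

/-! ### Price increments, and the experiments given by partial paths, full paths and `φ`. -/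

section Increments

variable {Ω : Type*} [MeasurableSpace Ω] {Γ : Set ℝ} {T σ S₀ v : ℝ} {f : ℝ → ℝ → ℝ} {G : ℝ → ℝ}
  {P : ℝ → Measure Ω} {S : ℝ → Ω → ℝ}

theorem intervalIntegrable_of_mem_Icc (hG : IntervalIntegrable G volume 0 T) {a b : ℝ}
    (ha : a ∈ Set.Icc 0 T) (hb : b ∈ Set.Icc 0 T) : IntervalIntegrable G volume a b :=
  hG.mono_set (Set.uIcc_subset_uIcc (Set.Icc_subset_uIcc ha) (Set.Icc_subset_uIcc hb))

/-- The substitution `s ↦ t - s` turns the convolution into a primitive of `G`, which makes the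
drift of each increment a scalar multiple of a cell integral. -/
theorem IsPropagatorModel.ae_path (hS : IsPropagatorModel Γ T σ S₀ v f G P S) {θ : ℝ}
    (hθ : θ ∈ Γ) : ∃ W : ℝ≥0 → Ω → ℝ, IsBrownianReal W (P θ) ∧
      ∀ᵐ ω ∂(P θ), ∀ t ∈ Set.Icc 0 T,
        S t ω = S₀ + f v θ * (∫ s in (0 : ℝ)..t, G s) + σ * W t.toNNReal ω := by
  obtain ⟨W, hW, h⟩ := hS θ hθ
  refine ⟨W, hW, h.mono fun ω hω t ht => ?_⟩
  rw [hω t ht, intervalIntegral.integral_const_mul, intervalIntegral.integral_comp_sub_left]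
  simp

theorem IsPropagatorModel.ae_initial (hS : IsPropagatorModel Γ T σ S₀ v f G P S) (hT : 0 < T)
    {θ : ℝ} (hθ : θ ∈ Γ) : ∀ᵐ ω ∂(P θ), S 0 ω = S₀ := by
  obtain ⟨W, hW, h⟩ := hS.ae_path hθ
  filter_upwards [h, hW.eval_zero_ae_eq_zero] with ω hω h0
  rw [hω 0 ⟨le_rfl, hT.le⟩]
  simp [h0]

theorem IsPropagatorModel.ae_continuousOn (hS : IsPropagatorModel Γ T σ S₀ v f G P S)
    (hT : 0 < T) (hG : IntervalIntegrable G volume 0 T) {θ : ℝ} (hθ : θ ∈ Γ) :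
    ∀ᵐ ω ∂(P θ), ContinuousOn (fun t => S t ω) (Set.Icc 0 T) := by
  obtain ⟨W, hW, h⟩ := hS.ae_path hθ
  filter_upwards [h, hW.cont] with ω hω hc
  have h1 : ContinuousOn (fun t => ∫ s in (0 : ℝ)..t, G s) (Set.Icc 0 T) := by
    have := intervalIntegral.continuousOn_primitive_interval' hG Set.left_mem_uIcc
    rwa [Set.uIcc_of_le hT.le] at this
  refine ContinuousOn.congr ?_ hω
  have h2 : Continuous fun t : ℝ => W t.toNNReal ω := hc.comp continuous_real_toNNReal
  exact (continuousOn_const.add (continuousOn_const.mul h1)).add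
    (continuous_const.mul h2).continuousOn

/-- The increments of the price process along a finite time grid are independent and Gaussian. -/
theorem IsPropagatorModel.hasLaw_increments (hS : IsPropagatorModel Γ T σ S₀ v f G P S)
    (hT : 0 < T) (hG : IntervalIntegrable G volume 0 T) {θ : ℝ} (hθ : θ ∈ Γ) {n : ℕ}
    {t : Fin (n + 1) → ℝ} (ht : Monotone t) (hmem : ∀ i, t i ∈ Set.Icc 0 T) :
    HasLaw (fun ω (i : Fin n) => S (t i.succ) ω - S (t i.castSucc) ω)
      (Measure.pi fun i : Fin n => gaussianReal (f v θ * ∫ s in (t i.castSucc)..(t i.succ), G s)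
        (Real.toNNReal (σ ^ 2 * (t i.succ - t i.castSucc)))) (P θ) := by
  obtain ⟨W, hW, h⟩ := hS.ae_path hθ
  have hlaw : ∀ i : Fin n, HasLaw
      (fun ω => f v θ * (∫ s in (t i.castSucc)..(t i.succ), G s) +
        σ * (W (t i.succ).toNNReal ω - W (t i.castSucc).toNNReal ω))
      (gaussianReal (f v θ * ∫ s in (t i.castSucc)..(t i.succ), G s)
        (Real.toNNReal (σ ^ 2 * (t i.succ - t i.castSucc)))) (P θ) := by
    intro i
    have h1 := gaussianReal_const_add (gaussianReal_const_mul
      (hW.hasLaw_sub (t i.succ).toNNReal (t i.castSucc).toNNReal) σ)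
      (f v θ * ∫ s in (t i.castSucc)..(t i.succ), G s)
    convert h1 using 3
    · simp
    · simp
    · have hle : t i.castSucc ≤ t i.succ := ht i.castSucc_lt_succ.le
      refine NNReal.coe_injective ?_
      rw [Real.coe_toNNReal _ (mul_nonneg (sq_nonneg _) (sub_nonneg.2 hle))]
      simp only [NNReal.coe_mul, NNReal.coe_mk, coe_nndist, Real.dist_eq]
      congr 1
      change _ = |((t i.succ).toNNReal : ℝ) - ((t i.castSucc).toNNReal : ℝ)|
      rw [Real.coe_toNNReal _ (hmem _).1, Real.coe_toNNReal _ (hmem _).1,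
        abs_of_nonneg (sub_nonneg.2 hle)]
  have hind := (hW.hasIndepIncrements n (fun i => (t i).toNNReal)
    (fun i j hij => Real.toNNReal_mono (ht hij))).comp
    (fun i x => f v θ * (∫ s in (t i.castSucc)..(t i.succ), G s) + σ * x) (fun i => by fun_prop)
  refine (hind.hasLaw_pi hlaw).congr ?_
  filter_upwards [h] with ω hω
  funext i
  rw [hω _ (hmem i.succ), hω _ (hmem i.castSucc),
    ← intervalIntegral.integral_add_adjacent_intervals
      (intervalIntegrable_of_mem_Icc hG ⟨le_rfl, hT.le⟩ (hmem i.castSucc))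
      (intervalIntegrable_of_mem_Icc hG (hmem i.castSucc) (hmem i.succ))]
  ring

/-- Telescoping. As the initial price is known, this recovers the path from its increments. -/
theorem path_eq_add_partialSum {n : ℕ} (x : Fin (n + 1) → ℝ) (i : Fin (n + 1)) :
    x i = x 0 + Fin.partialSum (fun j : Fin n => x j.succ - x j.castSucc) i := by
  induction i using Fin.induction with
  | zero => simp
  | succ j ih => rw [Fin.partialSum_succ, ← add_assoc, ← ih]; ring

@[fun_prop]
theorem measurable_partialSum {n : ℕ} (i : Fin (n + 1)) :
    Measurable fun y : Fin n → ℝ => Fin.partialSum y i := by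
  induction i using Fin.induction with
  | zero => simp
  | succ j ih =>
    simp only [Fin.partialSum_succ]
    fun_prop

theorem mem_Icc_of_monotone {n : ℕ} {t : Fin (n + 1) → ℝ} (ht : Monotone t) (h0 : t 0 = 0)
    (hlast : t (Fin.last n) ≤ T) (i : Fin (n + 1)) : t i ∈ Set.Icc 0 T :=
  ⟨h0 ▸ ht (Fin.zero_le i), (ht (Fin.le_last i)).trans hlast⟩

/-- The variance of a cell vanishes only when the cell is a point; this supplies the compatibility
condition of the Gaussian shift lemmas. -/
theorem integral_eq_zero_of_toNNReal_eq_zero (hσ : 0 < σ) {a b : ℝ}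
    (h : Real.toNNReal (σ ^ 2 * (b - a)) = 0) (hab : a ≤ b) : ∫ s in a..b, G s = 0 := by
  have h1 : σ ^ 2 * (b - a) ≤ 0 := Real.toNNReal_eq_zero.1 h
  have h2 : 0 < σ ^ 2 := by positivity
  have : a = b := by nlinarith
  simp [this]

theorem IsPropagatorModel.hasFisherInfo_partialPath (hS : IsPropagatorModel Γ T σ S₀ v f G P S)
    (hT : 0 < T) (hσ : 0 < σ) (hG : IntervalIntegrable G volume 0 T) {θ : ℝ}
    (hθ : θ ∈ interior Γ) (hf : DifferentiableAt ℝ (fun η => f v η) θ) {n : ℕ}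
    {t : Fin (n + 1) → ℝ} (ht : Monotone t) (h0 : t 0 = 0) (hlast : t (Fin.last n) ≤ T) :
    HasFisherInfo (experiment P (partialPath S t)) θ
      ((deriv (fun η => f v η) θ) ^ 2 / σ ^ 2 *
        ∑ i : Fin n, (∫ s in (t i.castSucc)..(t i.succ), G s) ^ 2 /
          (t i.succ - t i.castSucc)) := by
  have hmem := mem_Icc_of_monotone ht h0 hlast
  have hle : ∀ i : Fin n, t i.castSucc ≤ t i.succ := fun i => ht i.castSucc_lt_succ.le
  have key := hasFisherInfo_of_pi_gaussianReal (Q := experiment P (partialPath S t)) hf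
    (g := fun i : Fin n => ∫ s in (t i.castSucc)..(t i.succ), G s)
    (v := fun i => Real.toNNReal (σ ^ 2 * (t i.succ - t i.castSucc)))
    (fun i hi => integral_eq_zero_of_toNNReal_eq_zero hσ hi (hle i))
    -- `A` rebuilds the path from the increments, and `ℓ` reads the natural statistic off the
    -- differences of the path.
    (A := fun y i => S₀ + Fin.partialSum y i) (by fun_prop)
    (ℓ := fun x => ∑ i : Fin n, (∫ s in (t i.castSucc)..(t i.succ), G s) *
      (x i.succ - x i.castSucc) / Real.toNNReal (σ ^ 2 * (t i.succ - t i.castSucc)))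
    (by fun_prop) (fun x => by simp [Fin.partialSum_succ]) ?_
  · convert key using 1
    rw [div_mul_eq_mul_div, mul_div_assoc, Finset.sum_div]
    congr 1
    refine Finset.sum_congr rfl fun i _ => ?_
    rw [Real.coe_toNNReal _ (mul_nonneg (sq_nonneg _) (sub_nonneg.2 (hle i))), div_div, mul_comm]
  -- The likelihood is needed for all parameters near `θ`, hence the interior point.
  · filter_upwards [isOpen_interior.mem_nhds hθ] with η hη
    have hη' := interior_subset hη
    have hlaw := hS.hasLaw_increments hT hG hη' ht hmem
    rw [← hlaw.map_eq, AEMeasurable.map_map_of_aemeasurable (by fun_prop) hlaw.aemeasurable]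
    refine Measure.map_congr ?_
    filter_upwards [hS.ae_initial hT hη'] with ω hω
    funext i
    have := path_eq_add_partialSum (partialPath S t ω) i
    rw [this]
    simp [partialPath, h0, hω]

theorem gridPt_succ (T : ℝ) (N i : ℕ) : gridPt T N (i + 1) = gridPt T N i + T / N := by
  simp only [gridPt]
  push_cast
  ring

theorem gridPt_mono (hT : 0 < T) (N : ℕ) : Monotone (gridPt T N) :=
  monotone_nat_of_le_succ fun i => by
    rw [gridPt_succ]
    have : 0 ≤ T / N := by positivity
    linarith

theorem gridPt_zero (T : ℝ) (N : ℕ) : gridPt T N 0 = 0 := by simp [gridPt]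

theorem gridPt_self (T : ℝ) {N : ℕ} (hN : 0 < N) : gridPt T N N = T := by
  have : (N : ℝ) ≠ 0 := by positivity
  simp only [gridPt]
  field_simp

theorem gridPt_mem_Icc (hT : 0 < T) {N i : ℕ} (hN : 0 < N) (hi : i ≤ N) :
    gridPt T N i ∈ Set.Icc 0 T :=
  ⟨by rw [← gridPt_zero T N]; exact gridPt_mono hT N (Nat.zero_le i),
    (gridPt_mono hT N hi).trans_eq (gridPt_self T hN)⟩

/-- The increments of the price process along the full grid are independent and Gaussian. -/
theorem IsPropagatorModel.hasLaw_gridIncrements (hS : IsPropagatorModel Γ T σ S₀ v f G P S)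
    (hT : 0 < T) (hG : IntervalIntegrable G volume 0 T) {θ : ℝ} (hθ : θ ∈ Γ) {N : ℕ}
    (hN : 0 < N) :
    HasLaw (fun ω (i : Fin N) => S (gridPt T N (i + 1)) ω - S (gridPt T N i) ω)
      (Measure.pi fun i : Fin N => gaussianReal
        (f v θ * ∫ s in (gridPt T N i)..(gridPt T N (i + 1)), G s)
        (Real.toNNReal (σ ^ 2 * (T / N)))) (P θ) := by
  have := hS.hasLaw_increments hT hG hθ (t := fun i : Fin (N + 1) => gridPt T N i)
    (fun i j hij => gridPt_mono hT N hij)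
    (fun i => gridPt_mem_Icc hT hN (Nat.lt_succ_iff.1 i.2))
  simpa [gridPt_succ] using this

/-- The path along the full grid, in terms of its increments. -/
noncomputable def fullPathOfIncrements (S₀ : ℝ) {N : ℕ} (y : Fin N → ℝ) : Fin N → ℝ :=
  fun i => S₀ + Fin.partialSum y i.succ

@[fun_prop]
theorem measurable_fullPathOfIncrements (S₀ : ℝ) (N : ℕ) :
    Measurable (fullPathOfIncrements S₀ : (Fin N → ℝ) → Fin N → ℝ) := by
  unfold fullPathOfIncrements
  fun_prop

/-- Since all cells have the same variance, this linear form is the natural statistic up to a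
constant factor. -/
theorem phi_fullPathOfIncrements (T S₀ : ℝ) (G : ℝ → ℝ) (N : ℕ) (y : Fin N → ℝ) :
    phi T S₀ G N (fullPathOfIncrements S₀ y) =
      ∑ i : Fin N, (∫ s in (gridPt T N i)..(gridPt T N (i + 1)), G s) * y i := by
  have hcons : (Fin.cons S₀ (fullPathOfIncrements S₀ y) : Fin (N + 1) → ℝ) =
      fun i => S₀ + Fin.partialSum y i := by
    funext i
    refine Fin.cases ?_ (fun j => ?_) i
    · simp
    · simp [fullPathOfIncrements]
  unfold phi
  rw [hcons]
  refine Finset.sum_congr rfl fun i _ => ?_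
  simp only [Fin.partialSum_succ]
  ring

@[fun_prop]
theorem measurable_phi (T S₀ : ℝ) (G : ℝ → ℝ) (N : ℕ) : Measurable (phi T S₀ G N) := by
  have h : ∀ i : Fin (N + 1),
      Measurable fun x : Fin N → ℝ => (Fin.cons S₀ x : Fin (N + 1) → ℝ) i := by
    intro i
    refine Fin.cases ?_ (fun j => ?_) i
    · simp
    · simpa using measurable_pi_apply j
  unfold phi
  exact Finset.measurable_sum _ fun i _ => ((h _).sub (h _)).mul_const _

theorem IsPropagatorModel.ae_fullPath (hS : IsPropagatorModel Γ T σ S₀ v f G P S) (hT : 0 < T)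
    {θ : ℝ} (hθ : θ ∈ Γ) (N : ℕ) :
    ∀ᵐ ω ∂(P θ), fullPath T S N ω = fullPathOfIncrements S₀
      (fun i : Fin N => S (gridPt T N (i + 1)) ω - S (gridPt T N i) ω) := by
  filter_upwards [hS.ae_initial hT hθ] with ω hω
  funext i
  have := path_eq_add_partialSum (fun j : Fin (N + 1) => S (gridPt T N j) ω) i.succ
  simpa [fullPath, fullPathOfIncrements, gridPt_zero, hω] using this

theorem IsPropagatorModel.experiment_fullPath (hS : IsPropagatorModel Γ T σ S₀ v f G P S)
    (hT : 0 < T) (hG : IntervalIntegrable G volume 0 T) {θ : ℝ} (hθ : θ ∈ Γ) {N : ℕ}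
    (hN : 0 < N) :
    experiment P (fullPath T S N) θ = (Measure.pi fun i : Fin N => gaussianReal
        (f v θ * ∫ s in (gridPt T N i)..(gridPt T N (i + 1)), G s)
        (Real.toNNReal (σ ^ 2 * (T / N)))).map (fullPathOfIncrements S₀) := by
  have hlaw := hS.hasLaw_gridIncrements hT hG hθ hN
  rw [← hlaw.map_eq, AEMeasurable.map_map_of_aemeasurable (by fun_prop) hlaw.aemeasurable]
  exact Measure.map_congr (hS.ae_fullPath hT hθ N)

theorem toNNReal_step_ne_zero (hT : 0 < T) (hσ : 0 < σ) {N : ℕ} (hN : 0 < N) :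
    Real.toNNReal (σ ^ 2 * (T / N)) ≠ 0 := by
  have : 0 < σ ^ 2 * (T / N) := by positivity
  exact (Real.toNNReal_pos.2 this).ne'

theorem IsPropagatorModel.isSufficient_phi (hS : IsPropagatorModel Γ T σ S₀ v f G P S)
    (hT : 0 < T) (hσ : 0 < σ) (hG : IntervalIntegrable G volume 0 T) {N : ℕ} (hN : 0 < N) :
    IsSufficient Γ (experiment P (fullPath T S N)) (phi T S₀ G N) := by
  have hV := toNNReal_step_ne_zero hT hσ hN
  set V := Real.toNNReal (σ ^ 2 * (T / N)) with hVdef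
  refine isSufficient_of_withDensity (measurable_phi T S₀ G N)
    ((Measure.pi fun _ : Fin N => gaussianReal 0 V).map (fullPathOfIncrements S₀))
    (fun θ y => ENNReal.ofReal (Real.exp (f v θ * (y / V) - f v θ ^ 2 *
      (∑ i : Fin N, (∫ s in (gridPt T N i)..(gridPt T N (i + 1)), G s) ^ 2 / V) / 2)))
    (fun θ => by fun_prop) fun θ hθ => ?_
  rw [hS.experiment_fullPath hT hG hθ hN]
  refine map_pi_gaussianReal_eq_withDensity (v := fun _ => V) (fun _ h => absurd h hV)
    (by fun_prop) (ℓ := fun x => phi T S₀ G N x / V) (by fun_prop) (fun x => ?_) _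
  rw [phi_fullPathOfIncrements, Finset.sum_div]

theorem IsPropagatorModel.hasFisherInfo_fullPath (hS : IsPropagatorModel Γ T σ S₀ v f G P S)
    (hT : 0 < T) (hσ : 0 < σ) (hG : IntervalIntegrable G volume 0 T) {θ : ℝ}
    (hθ : θ ∈ interior Γ) (hf : DifferentiableAt ℝ (fun η => f v η) θ) {N : ℕ} (hN : 0 < N) :
    HasFisherInfo (experiment P (fullPath T S N)) θ
      ((deriv (fun η => f v η) θ) ^ 2 / σ ^ 2 *
        ∑ i : Fin N, (∫ s in (gridPt T N i)..(gridPt T N (i + 1)), G s) ^ 2 / (T / N)) := by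
  have hV := toNNReal_step_ne_zero hT hσ hN
  have hVc : ((Real.toNNReal (σ ^ 2 * (T / N)) : ℝ≥0) : ℝ) = σ ^ 2 * (T / N) :=
    Real.coe_toNNReal _ (by positivity)
  set V := Real.toNNReal (σ ^ 2 * (T / N)) with hVdef
  have key := hasFisherInfo_of_pi_gaussianReal (Q := experiment P (fullPath T S N)) hf
    (g := fun i : Fin N => ∫ s in (gridPt T N i)..(gridPt T N (i + 1)), G s)
    (v := fun _ => V) (fun _ h => absurd h hV) (A := fullPathOfIncrements S₀) (by fun_prop)
    (ℓ := fun x => phi T S₀ G N x / V) (by fun_prop)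
    (fun x => by rw [phi_fullPathOfIncrements, Finset.sum_div]) ?_
  · convert key using 1
    rw [div_mul_eq_mul_div, mul_div_assoc, Finset.sum_div]
    congr 1
    refine Finset.sum_congr rfl fun i _ => ?_
    rw [hVc, div_div, mul_comm (T / N)]
  · filter_upwards [isOpen_interior.mem_nhds hθ] with η hη
    exact hS.experiment_fullPath hT hG (interior_subset hη) hN

/-- Observing `φ` retains the natural statistic `φ / V`, so the value is that of the full path. -/
theorem IsPropagatorModel.hasFisherInfo_phi (hS : IsPropagatorModel Γ T σ S₀ v f G P S)
    (hT : 0 < T) (hσ : 0 < σ) (hG : IntervalIntegrable G volume 0 T) {θ : ℝ}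
    (hθ : θ ∈ interior Γ) (hf : DifferentiableAt ℝ (fun η => f v η) θ) {N : ℕ} (hN : 0 < N) :
    HasFisherInfo (experiment P (fun ω => phi T S₀ G N (fullPath T S N ω))) θ
      ((deriv (fun η => f v η) θ) ^ 2 / σ ^ 2 *
        ∑ i : Fin N, (∫ s in (gridPt T N i)..(gridPt T N (i + 1)), G s) ^ 2 / (T / N)) := by
  have hV := toNNReal_step_ne_zero hT hσ hN
  have hVc : ((Real.toNNReal (σ ^ 2 * (T / N)) : ℝ≥0) : ℝ) = σ ^ 2 * (T / N) :=
    Real.coe_toNNReal _ (by positivity)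
  set V := Real.toNNReal (σ ^ 2 * (T / N)) with hVdef
  have key := hasFisherInfo_of_pi_gaussianReal
    (Q := experiment P (fun ω => phi T S₀ G N (fullPath T S N ω))) hf
    (g := fun i : Fin N => ∫ s in (gridPt T N i)..(gridPt T N (i + 1)), G s)
    (v := fun _ => V) (fun _ h => absurd h hV)
    (A := fun y => phi T S₀ G N (fullPathOfIncrements S₀ y)) (by fun_prop)
    (ℓ := fun x => x / V) (by fun_prop)
    (fun x => by rw [phi_fullPathOfIncrements, Finset.sum_div]) ?_
  · convert key using 1
    rw [div_mul_eq_mul_div, mul_div_assoc, Finset.sum_div]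
    congr 1
    refine Finset.sum_congr rfl fun i _ => ?_
    rw [hVc, div_div, mul_comm (T / N)]
  · filter_upwards [isOpen_interior.mem_nhds hθ] with η hη
    have hη' := interior_subset hη
    have hlaw := hS.hasLaw_gridIncrements hT hG hη' hN
    rw [← hlaw.map_eq, AEMeasurable.map_map_of_aemeasurable (by fun_prop) hlaw.aemeasurable]
    refine Measure.map_congr ?_
    filter_upwards [hS.ae_fullPath hT hη' N] with ω hω
    rw [hω]
    rfl

end Increments

/-! ### Discrete and true VWAP costs. -/

section Cost

variable {Ω : Type*} [MeasurableSpace Ω] {Γ : Set ℝ} {T σ S₀ v : ℝ} {f : ℝ → ℝ → ℝ} {G : ℝ → ℝ}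
  {P : ℝ → Measure Ω} {S : ℝ → Ω → ℝ}

/-- Abel summation along the grid. -/
theorem vwapCostDiscrete_eq {Ω : Type*} (T : ℝ) (S : ℝ → Ω → ℝ) {N : ℕ} (hN : 0 < N) (ω : Ω) :
    vwapCostDiscrete T S N ω = S 0 ω * T + ∑ i : Fin N, (T - gridPt T N i) *
      (S (gridPt T N (i + 1)) ω - S (gridPt T N i) ω) := by
  unfold vwapCostDiscrete
  rw [Fin.sum_univ_eq_sum_range (fun i => S (gridPt T N (i + 1)) ω * (T / N)),
    Fin.sum_univ_eq_sum_range (fun i => (T - gridPt T N i) *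
      (S (gridPt T N (i + 1)) ω - S (gridPt T N i) ω))]
  -- The telescoping sum of `(T - t_i) S_{t_i}` has boundary terms `0` at `T` and `T * S 0 ω` at
  -- time `0`.
  have h := Finset.sum_range_sub (fun i => (T - gridPt T N i) * S (gridPt T N i) ω) N
  simp only [gridPt_self T hN, gridPt_zero] at h
  have h2 : ∀ i, (T - gridPt T N i) * (S (gridPt T N (i + 1)) ω - S (gridPt T N i) ω) =
      ((T - gridPt T N (i + 1)) * S (gridPt T N (i + 1)) ω -
        (T - gridPt T N i) * S (gridPt T N i) ω) + S (gridPt T N (i + 1)) ω * (T / N) := by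
    intro i
    rw [gridPt_succ]
    ring
  simp_rw [h2]
  rw [Finset.sum_add_distrib, h]
  ring

/-- The mean coefficient of the discrete VWAP cost. -/
noncomputable def costMean (T : ℝ) (G : ℝ → ℝ) (N : ℕ) : ℝ :=
  ∑ i : Fin N, (T - gridPt T N i) * ∫ s in (gridPt T N i)..(gridPt T N (i + 1)), G s

/-- The variance of the discrete VWAP cost. -/
noncomputable def costVar (T σ : ℝ) (N : ℕ) : ℝ :=
  ∑ i : Fin N, (T - gridPt T N i) ^ 2 * (σ ^ 2 * (T / N))

theorem IsPropagatorModel.hasLaw_vwapCostDiscrete (hS : IsPropagatorModel Γ T σ S₀ v f G P S)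
    (hT : 0 < T) (hG : IntervalIntegrable G volume 0 T) {θ : ℝ} (hθ : θ ∈ Γ) {N : ℕ}
    (hN : 0 < N) :
    HasLaw (vwapCostDiscrete T S N)
      (gaussianReal (S₀ * T + f v θ * costMean T G N) (Real.toNNReal (costVar T σ N))) (P θ) := by
  have hlaw := hS.hasLaw_gridIncrements hT hG hθ hN
  have hlin : HasLaw (fun y : Fin N → ℝ => ∑ i : Fin N, (T - gridPt T N i) * y i)
      (gaussianReal (f v θ * costMean T G N) (Real.toNNReal (costVar T σ N)))
      (Measure.pi fun i : Fin N => gaussianReal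
        (f v θ * ∫ s in (gridPt T N i)..(gridPt T N (i + 1)), G s)
        (Real.toNNReal (σ ^ 2 * (T / N)))) := by
    refine ⟨(Finset.measurable_sum _ fun i _ =>
      (measurable_pi_apply i).const_mul _).aemeasurable, ?_⟩
    rw [map_pi_gaussianReal_sum]
    congr 2
    · rw [costMean, Finset.mul_sum]
      exact Finset.sum_congr rfl fun i _ => by ring
    · rw [costVar]
      refine Finset.sum_congr rfl fun i _ => ?_
      rw [Real.coe_toNNReal _ (by positivity)]
  have h := gaussianReal_const_add (hlin.comp hlaw) (S₀ * T)
  rw [add_comm _ (S₀ * T)] at h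
  refine h.congr ?_
  filter_upwards [hS.ae_initial hT hθ] with ω hω
  rw [vwapCostDiscrete_eq T S hN, hω]
  rfl

theorem costVar_eq (T σ : ℝ) {N : ℕ} (hN : 0 < N) :
    costVar T σ N = σ ^ 2 * T ^ 3 * ((1 + 1 / (N : ℝ)) * (2 + 1 / (N : ℝ)) / 6) := by
  have hN' : (N : ℝ) ≠ 0 := by positivity
  -- The upper limit is separated from `N` so that induction applies.
  have h : ∀ n : ℕ, ∑ i ∈ Finset.range n, ((N : ℝ) - i) ^ 2 =
      n * (N : ℝ) ^ 2 - N * n * (n - 1) + n * (n - 1) * (2 * n - 1) / 6 := by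
    intro n
    induction n with
    | zero => simp
    | succ k ih => rw [Finset.sum_range_succ, ih]; push_cast; ring
  have h2 : costVar T σ N = ∑ i ∈ Finset.range N, σ ^ 2 * (T / N) ^ 3 * ((N : ℝ) - i) ^ 2 := by
    unfold costVar
    rw [Fin.sum_univ_eq_sum_range (fun i => (T - gridPt T N i) ^ 2 * (σ ^ 2 * (T / N)))]
    refine Finset.sum_congr rfl fun i _ => ?_
    simp only [gridPt]
    field_simp
  rw [h2, ← Finset.mul_sum, h]
  field_simp
  ring

theorem costVar_pos (hT : 0 < T) (hσ : 0 < σ) {N : ℕ} (hN : 0 < N) : 0 < costVar T σ N := by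
  rw [costVar_eq T σ hN]
  positivity

theorem tendsto_costVar (T σ : ℝ) :
    Tendsto (costVar T σ) atTop (𝓝 (σ ^ 2 * (T ^ 3 / 3))) := by
  have h1 := tendsto_one_div_atTop_nhds_zero_nat (𝕜 := ℝ)
  have h2 := (((h1.const_add 1).mul (h1.const_add 2)).div_const 6).const_mul (σ ^ 2 * T ^ 3)
  refine (h2.congr' ?_).trans (by ring_nf; rfl)
  filter_upwards [eventually_gt_atTop 0] with N hN
  rw [costVar_eq T σ hN]

theorem sum_integral_grid (hT : 0 < T) {h : ℝ → ℝ} (hh : IntervalIntegrable h volume 0 T) {N : ℕ}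
    (hN : 0 < N) :
    ∑ i : Fin N, ∫ s in (gridPt T N i)..(gridPt T N (i + 1)), h s = ∫ s in (0 : ℝ)..T, h s := by
  rw [Fin.sum_univ_eq_sum_range (fun i => ∫ s in (gridPt T N i)..(gridPt T N (i + 1)), h s),
    intervalIntegral.sum_integral_adjacent_intervals fun k hk => intervalIntegrable_of_mem_Icc hh
      (gridPt_mem_Icc hT hN hk.le) (gridPt_mem_Icc hT hN hk), gridPt_zero, gridPt_self T hN]

/-- On each cell the weights `T - t_i` and `T - s` differ by at most `T / N`, so the error is at
most `T / N * ∫ ‖G‖`; integrability of `G` is enough. -/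
theorem tendsto_costMean (hT : 0 < T) (hG : IntervalIntegrable G volume 0 T) :
    Tendsto (costMean T G) atTop (𝓝 (∫ t in (0 : ℝ)..T, G t * (T - t))) := by
  have hprod : IntervalIntegrable (fun t => G t * (T - t)) volume 0 T :=
    hG.mul_continuousOn (by fun_prop)
  rw [tendsto_iff_norm_sub_tendsto_zero]
  have hlim : Tendsto (fun N : ℕ => T / (N : ℝ) * ∫ s in (0 : ℝ)..T, ‖G s‖) atTop (𝓝 0) := by
    simpa using (tendsto_const_div_atTop_nhds_zero_nat T).mul_const (∫ s in (0 : ℝ)..T, ‖G s‖)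
  refine squeeze_zero' (Eventually.of_forall fun _ => norm_nonneg _) ?_ hlim
  filter_upwards [eventually_gt_atTop 0] with N hN
  have hcell : ∀ i : Fin N, IntervalIntegrable G volume (gridPt T N i) (gridPt T N (i + 1)) :=
    fun i => intervalIntegrable_of_mem_Icc hG (gridPt_mem_Icc hT hN i.2.le)
      (gridPt_mem_Icc hT hN i.2)
  rw [← sum_integral_grid hT hprod hN, ← sum_integral_grid hT hG.norm hN, costMean,
    ← Finset.sum_sub_distrib, Finset.mul_sum]
  refine (norm_sum_le _ _).trans (Finset.sum_le_sum fun i _ => ?_)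
  have hle : gridPt T N i ≤ gridPt T N (i + 1) := gridPt_mono hT N (Nat.le_succ _)
  rw [← intervalIntegral.integral_const_mul, ← intervalIntegral.integral_sub
    ((hcell i).const_mul _) ((hcell i).mul_continuousOn (by fun_prop)),
    ← intervalIntegral.integral_const_mul]
  refine intervalIntegral.norm_integral_le_of_norm_le hle ?_ ((hcell i).norm.const_mul _)
  refine Eventually.of_forall fun s hs => ?_
  rw [show (T - gridPt T N i) * G s - G s * (T - s) = (s - gridPt T N i) * G s by ring, norm_mul]
  refine mul_le_mul_of_nonneg_right ?_ (norm_nonneg _)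
  rw [gridPt_succ] at hs
  rw [Real.norm_eq_abs, abs_of_nonneg (by linarith [hs.1])]
  linarith [hs.2]

theorem tendsto_riemannSum (hT : 0 < T) {h : ℝ → ℝ} (hh : ContinuousOn h (Set.Icc 0 T)) :
    Tendsto (fun N : ℕ => ∑ i : Fin N, h (gridPt T N (i + 1)) * (T / N)) atTop
      (𝓝 (∫ t in (0 : ℝ)..T, h t)) := by
  have hint : IntervalIntegrable h volume 0 T :=
    ContinuousOn.intervalIntegrable (by rwa [Set.uIcc_of_le hT.le])
  rw [Metric.tendsto_atTop]
  intro ε hε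
  obtain ⟨δ, hδ, hu⟩ := Metric.uniformContinuousOn_iff.1
    (isCompact_Icc.uniformContinuousOn_of_continuous hh) (ε / (2 * T)) (by positivity)
  have hstep := (tendsto_const_div_atTop_nhds_zero_nat T).eventually (gt_mem_nhds hδ)
  obtain ⟨N₀, hN₀⟩ := eventually_atTop.1 (hstep.and (eventually_gt_atTop 0))
  refine ⟨N₀, fun N hN => ?_⟩
  obtain ⟨hNδ, hN⟩ := hN₀ N hN
  rw [← sum_integral_grid hT hint hN, dist_eq_norm, ← Finset.sum_sub_distrib]
  have hN' : (N : ℝ) ≠ 0 := by positivity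
  calc _ ≤ ∑ i : Fin N, ε / (2 * T) * (T / N) := (norm_sum_le _ _).trans
        (Finset.sum_le_sum fun i _ => ?_)
    _ = ε / 2 := by
        rw [Finset.sum_const, Finset.card_univ, Fintype.card_fin, nsmul_eq_mul]
        field_simp
    _ < ε := by linarith
  have hle : gridPt T N i ≤ gridPt T N (i + 1) := gridPt_mono hT N (Nat.le_succ _)
  have ha := gridPt_mem_Icc hT hN i.2.le
  have hb : gridPt T N (i + 1) ∈ Set.Icc 0 T := gridPt_mem_Icc hT hN i.2
  have hd : gridPt T N (i + 1) - gridPt T N i = T / N := by rw [gridPt_succ]; ring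
  have hc : h (gridPt T N (i + 1)) * (T / N) =
      ∫ _ in (gridPt T N i)..(gridPt T N (i + 1)), h (gridPt T N (i + 1)) := by
    rw [intervalIntegral.integral_const, hd, smul_eq_mul, mul_comm]
  rw [hc, ← intervalIntegral.integral_sub (by simp) (intervalIntegrable_of_mem_Icc hint ha hb)]
  have := intervalIntegral.norm_integral_le_of_norm_le_const
    (f := fun s => h (gridPt T N (i + 1)) - h s) (a := gridPt T N i) (b := gridPt T N (i + 1))
    (C := ε / (2 * T)) fun s hs => ?_
  · rwa [hd, abs_of_nonneg (by positivity : 0 ≤ T / (N : ℝ))] at this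
  · rw [Set.uIoc_of_le hle] at hs
    rw [← dist_eq_norm]
    refine (hu _ hb s ⟨ha.1.trans hs.1.le, hs.2.trans hb.2⟩ ?_).le
    rw [Real.dist_eq, abs_of_nonneg (by linarith [hs.2])]
    linarith [hs.1]

/-- An almost sure limit of Gaussian random variables is Gaussian. -/
theorem hasLaw_gaussianReal_of_tendsto {P : Measure Ω} {X : ℕ → Ω → ℝ} {Y : Ω → ℝ} {m : ℕ → ℝ}
    {V : ℕ → ℝ≥0} {m₀ : ℝ} {V₀ : ℝ≥0} (hX : ∀ n, HasLaw (X n) (gaussianReal (m n) (V n)) P)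
    (hXY : ∀ᵐ ω ∂P, Tendsto (fun n => X n ω) atTop (𝓝 (Y ω))) (hm : Tendsto m atTop (𝓝 m₀))
    (hV : Tendsto V atTop (𝓝 V₀)) : HasLaw Y (gaussianReal m₀ V₀) P := by
  have hprob := (hX 0).isProbabilityMeasure
  have hY : AEMeasurable Y P := aemeasurable_of_tendsto_metrizable_ae atTop
    (fun n => (hX n).aemeasurable) hXY
  refine ⟨hY, ?_⟩
  have : IsProbabilityMeasure (P.map Y) := Measure.isProbabilityMeasure_map hY
  refine Measure.ext_of_charFun ?_
  funext t
  have hchar : ∀ {Z : Ω → ℝ}, AEMeasurable Z P →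
      charFun (P.map Z) t = ∫ ω, Complex.exp (t * Z ω * Complex.I) ∂P := by
    intro Z hZ
    rw [charFun_apply_real, integral_map hZ (by fun_prop)]
  have h1 : Tendsto (fun n => charFun (P.map (X n)) t) atTop (𝓝 (charFun (P.map Y) t)) := by
    rw [hchar hY]
    simp_rw [fun n => hchar (hX n).aemeasurable]
    refine tendsto_integral_of_dominated_convergence (fun _ => 1) (fun n => ?_)
      (integrable_const _) (fun n => ?_) ?_
    · have := (hX n).aemeasurable
      have h2 : AEMeasurable (fun ω => Complex.exp (t * X n ω * Complex.I)) P := by fun_prop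
      exact h2.aestronglyMeasurable
    · refine Eventually.of_forall fun ω => ?_
      rw [← Complex.ofReal_mul, Complex.norm_exp_ofReal_mul_I]
    · filter_upwards [hXY] with ω hω
      have hc : Continuous fun x : ℝ => Complex.exp (t * x * Complex.I) := by fun_prop
      exact (hc.tendsto _).comp hω
  -- The Gaussian characteristic function is jointly continuous in mean and variance, including
  -- variance `0`, which identifies the limit.
  refine tendsto_nhds_unique h1 ?_
  simp_rw [(hX _).map_eq, charFun_gaussianReal]
  have hc : Continuous fun p : ℝ × ℝ≥0 =>
      Complex.exp (t * p.1 * Complex.I - (p.2 : ℝ) * t ^ 2 / 2) := by fun_prop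
  have h2 := (hc.tendsto (m₀, V₀)).comp (hm.prodMk_nhds hV)
  simp only [Function.comp_def] at h2
  exact h2

theorem IsPropagatorModel.hasLaw_vwapCost (hS : IsPropagatorModel Γ T σ S₀ v f G P S)
    (hT : 0 < T) (hG : IntervalIntegrable G volume 0 T) {θ : ℝ} (hθ : θ ∈ Γ) :
    HasLaw (vwapCost T S)
      (gaussianReal (S₀ * T + f v θ * ∫ t in (0 : ℝ)..T, G t * (T - t))
        (Real.toNNReal (σ ^ 2 * (T ^ 3 / 3)))) (P θ) := by
  -- The index `n + 1` avoids the empty grid. Continuity of the paths makes the discrete costs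
  -- converge as Riemann sums.
  refine hasLaw_gaussianReal_of_tendsto (X := fun n => vwapCostDiscrete T S (n + 1))
    (fun n => hS.hasLaw_vwapCostDiscrete hT hG hθ n.succ_pos) ?_
    ((((tendsto_costMean hT hG).comp (tendsto_add_atTop_nat 1)).const_mul _).const_add _)
    ((continuous_real_toNNReal.tendsto _).comp
      ((tendsto_costVar T σ).comp (tendsto_add_atTop_nat 1)))
  filter_upwards [hS.ae_continuousOn hT hG hθ] with ω hω
  exact (tendsto_riemannSum hT hω).comp (tendsto_add_atTop_nat 1)

theorem IsPropagatorModel.hasFisherInfo_vwapCostDiscrete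
    (hS : IsPropagatorModel Γ T σ S₀ v f G P S)
    (hT : 0 < T) (hσ : 0 < σ) (hG : IntervalIntegrable G volume 0 T) {θ : ℝ}
    (hθ : θ ∈ interior Γ) (hf : DifferentiableAt ℝ (fun η => f v η) θ) {N : ℕ} (hN : 0 < N) :
    HasFisherInfo (experiment P (vwapCostDiscrete T S N)) θ
      ((deriv (fun η => f v η) θ) ^ 2 * (costMean T G N ^ 2 / costVar T σ N)) := by
  have hpos := costVar_pos hT hσ hN
  have key := hasFisherInfo_of_gaussianReal (Q := experiment P (vwapCostDiscrete T S N)) hf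
    (b := S₀ * T) (k := costMean T G N) (V := Real.toNNReal (costVar T σ N))
    (fun h => absurd h (Real.toNNReal_pos.2 hpos).ne') ?_
  · rwa [Real.coe_toNNReal _ hpos.le] at key
  · filter_upwards [isOpen_interior.mem_nhds hθ] with η hη
    exact (hS.hasLaw_vwapCostDiscrete hT hG (interior_subset hη) hN).map_eq

theorem IsPropagatorModel.hasFisherInfo_vwapCost (hS : IsPropagatorModel Γ T σ S₀ v f G P S)
    (hT : 0 < T) (hσ : 0 < σ) (hG : IntervalIntegrable G volume 0 T) {θ : ℝ}
    (hθ : θ ∈ interior Γ) (hf : DifferentiableAt ℝ (fun η => f v η) θ) :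
    HasFisherInfo (experiment P (vwapCost T S)) θ
      ((deriv (fun η => f v η) θ) ^ 2 *
        ((∫ t in (0 : ℝ)..T, G t * (T - t)) ^ 2 / (σ ^ 2 * (T ^ 3 / 3)))) := by
  have hpos : 0 < σ ^ 2 * (T ^ 3 / 3) := by positivity
  have key := hasFisherInfo_of_gaussianReal (Q := experiment P (vwapCost T S)) hf
    (b := S₀ * T) (k := ∫ t in (0 : ℝ)..T, G t * (T - t))
    (V := Real.toNNReal (σ ^ 2 * (T ^ 3 / 3)))
    (fun h => absurd h (Real.toNNReal_pos.2 hpos).ne') ?_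
  · rwa [Real.coe_toNNReal _ hpos.le] at key
  · filter_upwards [isOpen_interior.mem_nhds hθ] with η hη
    exact (hS.hasLaw_vwapCost hT hG (interior_subset hη)).map_eq

theorem IsPropagatorModel.tendsto_fisherInfo_vwapCostDiscrete
    (hS : IsPropagatorModel Γ T σ S₀ v f G P S)
    (hT : 0 < T) (hσ : 0 < σ) (hG : IntervalIntegrable G volume 0 T) {θ : ℝ}
    (hθ : θ ∈ interior Γ) (hf : DifferentiableAt ℝ (fun η => f v η) θ) :
    Tendsto (fun N : ℕ => fisherInfo (experiment P (vwapCostDiscrete T S N)) θ) atTop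
      (𝓝 (fisherInfo (experiment P (vwapCost T S)) θ)) := by
  rw [(hS.hasFisherInfo_vwapCost hT hσ hG hθ hf).fisherInfo_eq]
  have hne : σ ^ 2 * (T ^ 3 / 3) ≠ 0 := by positivity
  refine ((((tendsto_costMean hT hG).pow 2).div (tendsto_costVar T σ) hne).const_mul _).congr' ?_
  filter_upwards [eventually_gt_atTop 0] with N hN
  exact (hS.hasFisherInfo_vwapCostDiscrete hT hσ hG hθ hf hN).fisherInfo_eq.symm

end Cost

/-! ### Convergence of the energy of cell averages, finite or infinite. -/

section EnergyLimit

variable {T : ℝ} {G : ℝ → ℝ}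

theorem setLIntegral_grid (hT : 0 < T) (F : ℝ → ℝ≥0∞) {N : ℕ} (hN : 0 < N) :
    ∫⁻ x in Set.Ioc 0 T, F x =
      ∑ i : Fin N, ∫⁻ x in Set.Ioc (gridPt T N i) (gridPt T N (i + 1)), F x := by
  rw [Fin.sum_univ_eq_sum_range
    (fun i => ∫⁻ x in Set.Ioc (gridPt T N i) (gridPt T N (i + 1)), F x)]
  have h : ∀ n : ℕ, ∫⁻ x in Set.Ioc 0 (gridPt T N n), F x =
      ∑ i ∈ Finset.range n, ∫⁻ x in Set.Ioc (gridPt T N i) (gridPt T N (i + 1)), F x := by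
    intro n
    induction n with
    | zero => simp [gridPt_zero]
    | succ k ih =>
      have h0 : 0 ≤ gridPt T N k := by
        rw [← gridPt_zero T N]
        exact gridPt_mono hT N (Nat.zero_le k)
      rw [Finset.sum_range_succ, ← ih,
        ← Set.Ioc_union_Ioc_eq_Ioc h0 (gridPt_mono hT N (Nat.le_succ k)),
        lintegral_union measurableSet_Ioc]
      exact Set.Ioc_disjoint_Ioc_of_le le_rfl
  rw [← h N, gridPt_self T hN]

/-- The index of the cell of the grid that contains `x`. -/
noncomputable def cellIndex (T : ℝ) (N : ℕ) (x : ℝ) : ℕ := ⌈x * N / T⌉₊ - 1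

theorem cellIndex_eq (hT : 0 < T) {N : ℕ} (hN : 0 < N) {i : ℕ} {x : ℝ}
    (hx : x ∈ Set.Ioc (gridPt T N i) (gridPt T N (i + 1))) : cellIndex T N x = i := by
  have hN' : (0 : ℝ) < N := by positivity
  simp only [gridPt, Set.mem_Ioc] at hx
  have : ⌈x * N / T⌉₊ = i + 1 := by
    rw [Nat.ceil_eq_iff (by omega), Nat.add_sub_cancel]
    constructor
    · rw [lt_div_iff₀ hT]
      have := mul_lt_mul_of_pos_right hx.1 hN'
      field_simp at this
      linarith
    · rw [div_le_iff₀ hT]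
      have := mul_le_mul_of_nonneg_right hx.2 hN'.le
      field_simp at this
      push_cast at this ⊢
      linarith
  simp [cellIndex, this]

theorem mem_cell (hT : 0 < T) {N : ℕ} (hN : 0 < N) {x : ℝ} (hx : x ∈ Set.Ioc 0 T) :
    cellIndex T N x < N ∧
      x ∈ Set.Ioc (gridPt T N (cellIndex T N x)) (gridPt T N (cellIndex T N x + 1)) := by
  have hN' : (0 : ℝ) < N := by positivity
  have hpos : 0 < x * N / T := div_pos (mul_pos hx.1 hN') hT
  have h1 : 0 < ⌈x * N / T⌉₊ := Nat.ceil_pos.2 hpos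
  have h2 : ⌈x * N / T⌉₊ = cellIndex T N x + 1 := by unfold cellIndex; omega
  have h3 := (Nat.ceil_eq_iff (by omega)).1 h2
  rw [Nat.add_sub_cancel] at h3
  refine ⟨?_, ?_, ?_⟩
  · have : ⌈x * N / T⌉₊ ≤ N := by
      rw [Nat.ceil_le, div_le_iff₀ hT, mul_comm]
      exact mul_le_mul_of_nonneg_left hx.2 hN'.le
    omega
  · have := (lt_div_iff₀ hT).1 h3.1
    rw [gridPt, mul_div_assoc', div_lt_iff₀ hN']
    exact this
  · have := (div_le_iff₀ hT).1 h3.2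
    rw [gridPt, mul_div_assoc', le_div_iff₀ hN']
    exact this

/-- Lebesgue differentiation along the cells of the grid. -/
theorem ae_tendsto_cellAverage (hT : 0 < T) (hG : IntervalIntegrable G volume 0 T) :
    ∀ᵐ x ∂(volume.restrict (Set.Ioc 0 T)),
      Tendsto (fun N : ℕ => (∫ s in (gridPt T N (cellIndex T N x))..(gridPt T N
        (cellIndex T N x + 1)), G s) / (T / N)) atTop (𝓝 (G x)) := by
  have hint : Integrable ((Set.Ioc 0 T).indicator G) volume :=
    (integrable_indicator_iff measurableSet_Ioc).2
      ((intervalIntegrable_iff_integrableOn_Ioc_of_le hT.le).1 hG)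
  rw [ae_restrict_iff' measurableSet_Ioc]
  -- The cells containing `x` are not centred at `x`. This form of Lebesgue differentiation allows
  -- balls with moving centres, and each closed cell is the ball of radius `T / N / 2` about its
  -- midpoint.
  filter_upwards [IsUnifLocDoublingMeasure.ae_tendsto_average volume hint.locallyIntegrable 1]
    with x hx hxT
  have hlim : Tendsto (fun N : ℕ => T / N / 2) atTop (𝓝[>] (0 : ℝ)) := by
    refine tendsto_nhdsWithin_iff.2 ⟨?_, ?_⟩
    · simpa using (tendsto_const_div_atTop_nhds_zero_nat T).div_const 2
    · filter_upwards [eventually_gt_atTop 0] with N hN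
      exact Set.mem_Ioi.2 (by positivity)
  have hball : ∀ N : ℕ, Metric.closedBall (gridPt T N (cellIndex T N x) + T / N / 2)
      (T / N / 2) = Set.Icc (gridPt T N (cellIndex T N x)) (gridPt T N (cellIndex T N x + 1)) := by
    intro N
    rw [Real.closedBall_eq_Icc, gridPt_succ]
    congr 1 <;> ring
  have key := hx (fun N : ℕ => gridPt T N (cellIndex T N x) + T / N / 2) (fun N => T / N / 2)
    hlim ?_
  · rw [Set.indicator_of_mem hxT] at key
    refine key.congr' ?_
    filter_upwards [eventually_gt_atTop 0] with N hN
    obtain ⟨hlt, hmem⟩ := mem_cell hT hN hxT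
    have hle := gridPt_mono hT N (Nat.le_succ (cellIndex T N x))
    rw [hball, setAverage_eq, integral_Icc_eq_integral_Ioc,
      intervalIntegral.integral_of_le hle, div_eq_inv_mul, smul_eq_mul]
    congr 1
    · rw [Real.volume_real_Icc_of_le hle, gridPt_succ, add_sub_cancel_left]
    · refine setIntegral_congr_fun measurableSet_Ioc fun s hs => Set.indicator_of_mem ?_ _
      exact ⟨(gridPt_mem_Icc hT hN hlt.le).1.trans_lt hs.1,
        hs.2.trans (gridPt_mem_Icc hT hN hlt).2⟩
  · filter_upwards [eventually_gt_atTop 0] with N hN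
    rw [one_mul, hball]
    exact Set.Ioc_subset_Icc_self (mem_cell hT hN hxT).2

/-- Cauchy–Schwarz, by expanding `∫ (G - c)² ≥ 0` with `c` the mean of `G`. If `∫ G²` is infinite
there is nothing to prove. -/
theorem ofReal_sq_integral_div_le {a b : ℝ} (hab : a < b) (hG : IntervalIntegrable G volume a b) :
    ENNReal.ofReal ((∫ s in a..b, G s) ^ 2 / (b - a)) ≤
      ∫⁻ s in Set.Ioc a b, ENNReal.ofReal (G s ^ 2) := by
  have hGi := (intervalIntegrable_iff_integrableOn_Ioc_of_le hab.le).1 hG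
  rcases eq_or_ne (∫⁻ s in Set.Ioc a b, ENNReal.ofReal (G s ^ 2)) ⊤ with htop | htop
  · rw [htop]; exact le_top
  have hsq : IntegrableOn (fun s => G s ^ 2) (Set.Ioc a b) := by
    refine ⟨hGi.aestronglyMeasurable.pow 2, ?_⟩
    rw [hasFiniteIntegral_iff_ofReal (Eventually.of_forall fun s => sq_nonneg _)]
    exact htop.lt_top
  rw [← ofReal_integral_eq_lintegral_ofReal hsq (Eventually.of_forall fun s => sq_nonneg _)]
  refine ENNReal.ofReal_le_ofReal ?_
  have hsq' : IntervalIntegrable (fun s => G s ^ 2) volume a b :=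
    (intervalIntegrable_iff_integrableOn_Ioc_of_le hab.le).2 hsq
  rw [← intervalIntegral.integral_of_le hab.le]
  set c := (∫ s in a..b, G s) / (b - a) with hc
  have hba : 0 < b - a := sub_pos.2 hab
  have h0 : 0 ≤ ∫ s in a..b, (G s - c) ^ 2 :=
    intervalIntegral.integral_nonneg hab.le fun s _ => sq_nonneg _
  have h1 : ∫ s in a..b, (G s - c) ^ 2 =
      (∫ s in a..b, G s ^ 2) - 2 * c * (∫ s in a..b, G s) + c ^ 2 * (b - a) := by
    have : ∀ s, (G s - c) ^ 2 = G s ^ 2 - 2 * c * G s + c ^ 2 := fun s => by ring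
    simp_rw [this]
    rw [intervalIntegral.integral_add (hsq'.sub (hG.const_mul _)) (by simp),
      intervalIntegral.integral_sub hsq' (hG.const_mul _), intervalIntegral.integral_const_mul,
      intervalIntegral.integral_const, smul_eq_mul, mul_comm (b - a)]
  have h2 : (∫ s in a..b, G s ^ 2) - 2 * c * (∫ s in a..b, G s) + c ^ 2 * (b - a) =
      (∫ s in a..b, G s ^ 2) - (∫ s in a..b, G s) ^ 2 / (b - a) := by
    rw [hc]
    field_simp
    ring
  linarith

/-- The energies of the cell averages of an integrable function converge to the energy of the
function, be it finite or not. -/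
theorem tendsto_ofReal_sum_sq_cell (hT : 0 < T) (hG : IntervalIntegrable G volume 0 T) :
    Tendsto (fun N : ℕ => ENNReal.ofReal
        (∑ i : Fin N, (∫ s in (gridPt T N i)..(gridPt T N (i + 1)), G s) ^ 2 / (T / N)))
      atTop (𝓝 (∫⁻ t in Set.Ioc 0 T, ENNReal.ofReal (G t ^ 2))) := by
  have hsum : ∀ N : ℕ, ENNReal.ofReal
      (∑ i : Fin N, (∫ s in (gridPt T N i)..(gridPt T N (i + 1)), G s) ^ 2 / (T / N)) =
      ∑ i : Fin N, ENNReal.ofReal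
        ((∫ s in (gridPt T N i)..(gridPt T N (i + 1)), G s) ^ 2 / (T / N)) :=
    fun N => ENNReal.ofReal_sum_of_nonneg fun i _ => by positivity
  -- A step function equal on each cell to the squared cell average; its integral is the sum in
  -- question.
  let F : ℕ → ℝ → ℝ≥0∞ := fun N x => ENNReal.ofReal (((∫ s in (gridPt T N (cellIndex T N x))..
    (gridPt T N (cellIndex T N x + 1)), G s) / (T / N)) ^ 2)
  have hFm : ∀ N, Measurable (F N) := by
    intro N
    have hc : Measurable (cellIndex T N) := by
      have h1 : Measurable fun x : ℝ => ⌈x * N / T⌉₊ := Nat.measurable_ceil.comp (by fun_prop)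
      exact (measurable_from_top (f := fun k : ℕ => k - 1)).comp h1
    exact (measurable_from_top (f := fun k : ℕ => ENNReal.ofReal (((∫ s in (gridPt T N k)..
      (gridPt T N (k + 1)), G s) / (T / N)) ^ 2))).comp hc
  have hFint : ∀ N : ℕ, 0 < N → ∫⁻ x in Set.Ioc 0 T, F N x = ENNReal.ofReal
      (∑ i : Fin N, (∫ s in (gridPt T N i)..(gridPt T N (i + 1)), G s) ^ 2 / (T / N)) := by
    intro N hN
    have hN' : (N : ℝ) ≠ 0 := by positivity
    rw [hsum, setLIntegral_grid hT _ hN]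
    refine Finset.sum_congr rfl fun i _ => ?_
    rw [setLIntegral_congr_fun (g := fun _ => ENNReal.ofReal (((∫ s in (gridPt T N i)..
      (gridPt T N (i + 1)), G s) / (T / N)) ^ 2)) measurableSet_Ioc
      (fun x hx => by simp only [F, cellIndex_eq hT hN hx]), setLIntegral_const,
      Real.volume_Ioc, gridPt_succ, add_sub_cancel_left, ← ENNReal.ofReal_mul (by positivity)]
    congr 1
    field_simp
  -- Fatou gives the lower bound, and Cauchy–Schwarz on each cell bounds every term by the limit. No
  -- dominating function is needed, so an infinite energy is allowed.
  refine tendsto_of_le_liminf_of_limsup_le ?_ ?_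
  · have hlim : ∀ᵐ x ∂(volume.restrict (Set.Ioc 0 T)),
        ENNReal.ofReal (G x ^ 2) = liminf (fun N => F N x) atTop := by
      filter_upwards [ae_tendsto_cellAverage hT hG] with x hx
      exact ((ENNReal.continuous_ofReal.tendsto _).comp (hx.pow 2)).liminf_eq.symm
    calc ∫⁻ t in Set.Ioc 0 T, ENNReal.ofReal (G t ^ 2)
        = ∫⁻ x in Set.Ioc 0 T, liminf (fun N => F N x) atTop := lintegral_congr_ae hlim
      _ ≤ liminf (fun N => ∫⁻ x in Set.Ioc 0 T, F N x) atTop := lintegral_liminf_le hFm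
      _ = _ := liminf_congr (by
          filter_upwards [eventually_gt_atTop 0] with N hN
          exact hFint N hN)
  · refine limsup_le_of_le (by isBoundedDefault) ?_
    filter_upwards [eventually_gt_atTop 0] with N hN
    rw [hsum, setLIntegral_grid hT _ hN]
    refine Finset.sum_le_sum fun i _ => ?_
    have hd : gridPt T N (i + 1) - gridPt T N i = T / N := by rw [gridPt_succ]; ring
    have hlt : gridPt T N i < gridPt T N (i + 1) := by
      have : 0 < T / N := by positivity
      linarith
    rw [← hd]
    exact ofReal_sq_integral_div_le hlt (intervalIntegrable_of_mem_Icc hG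
      (gridPt_mem_Icc hT hN i.2.le) (gridPt_mem_Icc hT hN i.2))

end EnergyLimit

/-! ### The limit of the full-path information. -/

section FullPathLimit

variable {Ω : Type*} [MeasurableSpace Ω] {Γ : Set ℝ} {T σ S₀ v : ℝ} {f : ℝ → ℝ → ℝ} {G : ℝ → ℝ}
  {P : ℝ → Measure Ω} {S : ℝ → Ω → ℝ}

theorem IsPropagatorModel.tendsto_ofReal_fisherInfo_fullPath
    (hS : IsPropagatorModel Γ T σ S₀ v f G P S)
    (hT : 0 < T) (hσ : 0 < σ) (hG : IntervalIntegrable G volume 0 T) {θ : ℝ}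
    (hθ : θ ∈ interior Γ) (hf : DifferentiableAt ℝ (fun η => f v η) θ) :
    Tendsto (fun N : ℕ => ENNReal.ofReal (fisherInfo (experiment P (fullPath T S N)) θ)) atTop
      (𝓝 (ENNReal.ofReal ((deriv (fun η => f v η) θ) ^ 2 / σ ^ 2) *
        ∫⁻ t in Set.Ioc 0 T, ENNReal.ofReal (G t ^ 2))) := by
  -- Multiplication by a finite constant is continuous on `[0, ∞]`, also at `∞`; the constant `0`
  -- gives `0 * ∞ = 0`.
  refine (ENNReal.Tendsto.const_mul (tendsto_ofReal_sum_sq_cell hT hG)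
    (Or.inr ENNReal.ofReal_ne_top)).congr' ?_
  filter_upwards [eventually_gt_atTop 0] with N hN
  rw [(hS.hasFisherInfo_fullPath hT hσ hG hθ hf hN).fisherInfo_eq,
    ENNReal.ofReal_mul (by positivity)]

theorem IsPropagatorModel.tendsto_fisherInfo_fullPath
    (hS : IsPropagatorModel Γ T σ S₀ v f G P S)
    (hT : 0 < T) (hσ : 0 < σ) (hG : IntervalIntegrable G volume 0 T) {θ : ℝ}
    (hθ : θ ∈ interior Γ) (hf : DifferentiableAt ℝ (fun η => f v η) θ)
    (hG2 : IntervalIntegrable (fun t => G t ^ 2) volume 0 T) :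
    Tendsto (fun N : ℕ => fisherInfo (experiment P (fullPath T S N)) θ) atTop
      (𝓝 ((deriv (fun η => f v η) θ) ^ 2 / σ ^ 2 * ∫ t in (0 : ℝ)..T, G t ^ 2)) := by
  have h := hS.tendsto_ofReal_fisherInfo_fullPath hT hσ hG hθ hf
  have hint0 : 0 ≤ ∫ t in (0 : ℝ)..T, G t ^ 2 :=
    intervalIntegral.integral_nonneg hT.le fun s _ => sq_nonneg _
  rw [← ofReal_integral_eq_lintegral_ofReal
    ((intervalIntegrable_iff_integrableOn_Ioc_of_le hT.le).1 hG2)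
    (Eventually.of_forall fun s => sq_nonneg _), ← intervalIntegral.integral_of_le hT.le,
    ← ENNReal.ofReal_mul (by positivity)] at h
  have h2 := (ENNReal.tendsto_toReal ENNReal.ofReal_ne_top).comp h
  rw [ENNReal.toReal_ofReal (by positivity)] at h2
  refine h2.congr' ?_
  filter_upwards [eventually_gt_atTop 0] with N hN
  simp only [Function.comp]
  rw [(hS.hasFisherInfo_fullPath hT hσ hG hθ hf hN).fisherInfo_eq,
    ENNReal.toReal_ofReal (by positivity)]

end FullPathLimit

end Propagator

/-- In the partial-trajectory formula, a summand with `t_{i-1} = t_i` (an observation that is merely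
repeated) is `0`. -/
theorem theorem3 {Ω : Type*} [MeasurableSpace Ω] (Γ : Set ℝ) (T σ S₀ v : ℝ)
    (hT : 0 < T) (hσ : 0 < σ) (f : ℝ → ℝ → ℝ) (G : ℝ → ℝ)
    (hG : IntervalIntegrable G volume 0 T)
    (P : ℝ → Measure Ω) (S : ℝ → Ω → ℝ)
    (hS : Propagator.IsPropagatorModel Γ T σ S₀ v f G P S) :
    -- the statistic `φ` is sufficient for the full-grid observations
    (∀ N : ℕ, 0 < N → Propagator.IsSufficient Γ
      (Propagator.experiment P (Propagator.fullPath T S N)) (Propagator.phi T S₀ G N)) ∧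
    ∀ θ ∈ interior Γ, DifferentiableAt ℝ (fun η => f v η) θ →
      -- `I_{S_full} = I_φ`
      (∀ N : ℕ, 0 < N → ∃ I : ℝ,
        Propagator.HasFisherInfo (Propagator.experiment P (Propagator.fullPath T S N)) θ I ∧
        Propagator.HasFisherInfo
          (Propagator.experiment P
            (fun ω => Propagator.phi T S₀ G N (Propagator.fullPath T S N ω))) θ I) ∧
      -- the limit of `I_{S_full}`, in `[0, ∞]`
      Tendsto (fun N : ℕ => ENNReal.ofReal
          (Propagator.fisherInfo (Propagator.experiment P (Propagator.fullPath T S N)) θ))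
        atTop (𝓝 (ENNReal.ofReal ((deriv (fun η => f v η) θ) ^ 2 / σ ^ 2) *
          ∫⁻ t in Set.Ioc 0 T, ENNReal.ofReal (G t ^ 2))) ∧
      -- the limit of `I_{S_full}`, as a real number, for a square integrable kernel
      (IntervalIntegrable (fun t => G t ^ 2) volume 0 T →
        Tendsto (fun N : ℕ =>
            Propagator.fisherInfo (Propagator.experiment P (Propagator.fullPath T S N)) θ)
          atTop (𝓝 ((deriv (fun η => f v η) θ) ^ 2 / σ ^ 2 * ∫ t in (0 : ℝ)..T, G t ^ 2))) ∧
      -- `I_{J_discrete} → I_J`, and the value of `I_J`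
      (∀ N : ℕ, 0 < N → ∃ I : ℝ,
        Propagator.HasFisherInfo
          (Propagator.experiment P (Propagator.vwapCostDiscrete T S N)) θ I) ∧
      Tendsto (fun N : ℕ =>
          Propagator.fisherInfo (Propagator.experiment P (Propagator.vwapCostDiscrete T S N)) θ)
        atTop (𝓝 (Propagator.fisherInfo (Propagator.experiment P (Propagator.vwapCost T S)) θ)) ∧
      Propagator.HasFisherInfo (Propagator.experiment P (Propagator.vwapCost T S)) θ
        ((deriv (fun η => f v η) θ) ^ 2 / σ ^ 2 *
          (3 / T ^ 3 * (∫ t in (0 : ℝ)..T, G t * (T - t)) ^ 2)) ∧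
      -- the value of `I_{S_partial}`
      (∀ (n : ℕ) (t : Fin (n + 1) → ℝ), Monotone t → t 0 = 0 → t (Fin.last n) ≤ T →
        Propagator.HasFisherInfo (Propagator.experiment P (Propagator.partialPath S t)) θ
          ((deriv (fun η => f v η) θ) ^ 2 / σ ^ 2 *
            ∑ i : Fin n, (∫ s in (t i.castSucc)..(t i.succ), G s) ^ 2 /
              (t i.succ - t i.castSucc))) := by
  refine ⟨fun N hN => hS.isSufficient_phi hT hσ hG hN, fun θ hθ hf => ⟨fun N hN =>
    ⟨_, hS.hasFisherInfo_fullPath hT hσ hG hθ hf hN, hS.hasFisherInfo_phi hT hσ hG hθ hf hN⟩,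
    hS.tendsto_ofReal_fisherInfo_fullPath hT hσ hG hθ hf,
    hS.tendsto_fisherInfo_fullPath hT hσ hG hθ hf,
    fun N hN => ⟨_, hS.hasFisherInfo_vwapCostDiscrete hT hσ hG hθ hf hN⟩,
    hS.tendsto_fisherInfo_vwapCostDiscrete hT hσ hG hθ hf, ?_,
    fun n t ht h0 hlast => hS.hasFisherInfo_partialPath hT hσ hG hθ hf ht h0 hlast⟩⟩
  convert hS.hasFisherInfo_vwapCost hT hσ hG hθ hf using 1
  field_simp
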